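/- Let $k\ge 1$, let $\mathbb{R}_{\max}=\mathbb{R}\cup\{-\infty\}$ with max-plus matrix product $(A\otimes B)_{ij}=\max_l(A_{il}+B_{lj})$ and powers $A^{\otimes n}$ ($n\ge 0$, $A^{\otimes 0}$ the max-plus identity). Let $\mathcal{M}_k$ be the set of $k\times k$ matrices over $\mathbb{R}_{\max}$ with no row of $-\infty$, and $\mathcal{P}_k$ the set of those $A\in\mathcal{M}_k$ for which some $A^{\otimes n}$ has only finite entries. Graphs. A path $p=(i_1,\dots,i_{n+1})$, $n\ge 1$, on the complete directed graph on $\{1,\dots,k\}$ (loops included) has length $|p|=n$ and weight $w(A,p)=\sum_{j\le n}A_{i_ji_{j+1}}$; it is elementary if no node is repeated, except that first and last node may coincide. A circuit is a closed path $c$, and $aw(A,c)=w(A,c)/|c|$. The graph $\mathcal{G}(A)$ has nodes $1,\dots,k$ and arcs the $(i,j)$ with $A_{ij}>-\infty$; $\rho_{\max}(A)$ is the maximum of $aw(A,c)$ over the elementary circuits $c$ of $\mathcal{G}(A)$; the critical graph consists of the nodes and arcs of $\mathcal{G}(A)$ that lie on circuits of average weight $\rho_{\max}(A)$. The cyclicity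 of a graph is the gcd of the lengths of its circuits if it is strongly connected, and otherwise the lcm of the cyclicities of its strongly connected components. A matrix is scs1-cyc1 if its critical graph has exactly one strongly connected component and cyclicity $1$. Hyperplanes. For a finite set $Q$ and $\alpha\in\mathbb{R}^Q$, the linear form $f_\alpha:\mathbb{R}_{\max}^Q\to\mathbb{R}_{\max}$ is $f_\alpha(V)=\sum_{\alpha_q\ne0}\alpha_qV_q$ if all $V_q$ with $\alpha_q\neq 0$ are finite, and $-\infty$ otherwise. A hyperplane of $\mathcal{P}_k\times\mathcal{M}_k$ is the set of its elements at which a given non-zero linear form of the $2k^2$ entries of $(A,B)$ vanishes. Consider the following linear forms. $\mathcal{E}_1$: the forms $aw(A,c_1)-aw(A,c_2)$, where $c_1,c_2$ are elementary circuits with different sets of arcs. $\mathcal{E}_2$: the forms $w(A,p_1)-|p_1|\,aw(A,c)-w(A,p_2)+|p_2|\,aw(A,c)$, where $p_1\ne p_2$ are elementary paths with the same initial node $i$ and the same final node $\kappa\ne i$, and $c$ is an elementary circuit through $\kappa$. $\mathcal{E}_3$: the forms $$B_{j_1m_1}-B_{j_2m_2}+w(A,q_1)-w(A,p_{i_1})+w(A,p_{m_1})-w(A,q_2)+w(A,p_{i_2})-w(A,p_{m_2})-\bigl(|q_1|-|p_{i_1}|+|p_{m_1}|-|q_2|+|p_{i_2}|-|p_{m_2}|\bigr)\,aw(A,p_\kappa),$$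 where $i_1,i_2,j_1,j_2,m_1,m_2,\kappa$ are nodes with $m_1\ne m_2$, $p_i$ is an elementary path from $i$ to $\kappa$ for each $i\in\{i_1,i_2,m_1,m_2,\kappa\}$, and $q_l$ is a path from $i_l$ to $j_l$ of length at most $k|p_\kappa|$, for $l=1,2$. Then $\mathcal{E}_1\cup\mathcal{E}_2\cup\mathcal{E}_3$ is a finite set of non-zero linear forms, so the set where at least one of them vanishes is a union of finitely many hyperplanes of $\mathcal{P}_k\times\mathcal{M}_k$. For every pair $(A,B)\in\mathcal{P}_k\times\mathcal{M}_k$ outside this union there are integers $m,n\ge 0$ such that the matrix $A^{\otimes m}\otimes B\otimes A^{\otimes n}$ has only finite entries and its critical graph has exactly one node; as a consequence, this matrix is scs1-cyc1. -/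

import Mathlib

namespace MaxPlus

/-- The max-plus semiring `ℝ ∪ {-∞}`: the max-plus sum is `⊔`, the max-plus product is `+`,
and `⊥` is `-∞`. -/
abbrev Rmax : Type := WithBot ℝ

/-- Square matrices of size `k` with entries in the max-plus semiring. -/
abbrev Mat (k : ℕ) : Type := Matrix (Fin k) (Fin k) Rmax

/-- Max-plus matrix product: `(A ⊗ B) i j = max_l (A i l + B l j)`. -/
noncomputable def mul {k : ℕ} (A B : Mat k) : Mat k :=
  fun i j => Finset.univ.sup fun l => A i l + B l j

/-- Max-plus identity matrix: `0` on the diagonal and `-∞` elsewhere. -/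
noncomputable def one (k : ℕ) : Mat k :=
  fun i j => if i = j then 0 else ⊥

/-- Max-plus matrix powers. -/
noncomputable def pow {k : ℕ} (A : Mat k) : ℕ → Mat k
  | 0 => one k
  | n + 1 => mul (pow A n) A

/-- All the entries of `A` are finite. -/
def HasFiniteEntries {k : ℕ} (A : Mat k) : Prop :=
  ∀ i j, A i j ≠ ⊥

/-- `𝓜_k`: the matrices with no row of `-∞`. -/
def matM (k : ℕ) : Set (Mat k) :=
  {A | ∀ i, ∃ j, A i j ≠ ⊥}

/-- `𝓟_k`: the primitive matrices. -/
def matP (k : ℕ) : Set (Mat k) :=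
  {A | A ∈ matM k ∧ ∃ n : ℕ, HasFiniteEntries (pow A n)}

/-! ### Directed graphs, paths and circuits -/

/-- A directed graph with nodes in `V`, given by its nodes and its arcs. -/
structure DirGraph (V : Type) where
  /-- the nodes -/
  nodes : Set V
  /-- `arc i j`: there is an arc from `i` to `j` -/
  arc : V → V → Prop
  /-- arcs start at nodes -/
  left_mem : ∀ {i j : V}, arc i j → i ∈ nodes
  /-- arcs end at nodes -/
  right_mem : ∀ {i j : V}, arc i j → j ∈ nodes

/-- The complete directed graph (loops included). -/
def completeDirGraph (V : Type) : DirGraph V where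
  nodes := Set.univ
  arc := fun _ _ => True
  left_mem := fun _ => Set.mem_univ _
  right_mem := fun _ => Set.mem_univ _

/-- The list of the arcs `(i₁,i₂), (i₂,i₃), …` of a path `(i₁,…,iₙ,iₙ₊₁)`. -/
def arcs {V : Type} (p : List V) : List (V × V) :=
  p.zip p.tail

/-- The length of a path: its number of arcs. -/
def len {V : Type} (p : List V) : ℕ :=
  (arcs p).length

/-- `p = (i₁,…,iₙ,iₙ₊₁)` is a path on `G`, with `n ≥ 1` arcs. -/
def DirGraph.IsPath {V : Type} (G : DirGraph V) (p : List V) : Prop :=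
  1 ≤ len p ∧ ∀ a ∈ arcs p, G.arc a.1 a.2

/-- `p` is a path on `G` from `i` to `j`. -/
def DirGraph.IsPathFromTo {V : Type} (G : DirGraph V) (i j : V) (p : List V) : Prop :=
  G.IsPath p ∧ p.head? = some i ∧ p.getLast? = some j

/-- A circuit is a closed path. -/
def DirGraph.IsCircuit {V : Type} (G : DirGraph V) (p : List V) : Prop :=
  G.IsPath p ∧ p.head? = p.getLast?

/-- A path is elementary if no node is repeated, except that its first and last nodes may
coincide. -/
def IsElementary {V : Type} (p : List V) : Prop :=
  p.dropLast.Nodup ∧ p.tail.Nodup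

/-- The elementary circuits of the complete directed graph on `[1,k]`. -/
def elemCircuits (k : ℕ) : Set (List (Fin k)) :=
  {c | (completeDirGraph (Fin k)).IsCircuit c ∧ IsElementary c}

theorem elemCircuits_finite (k : ℕ) : (elemCircuits k).Finite := by
  refine (List.finite_length_le (Fin k) (k + 1)).subset ?_
  intro c hc
  have h := hc.2.1.length_le_card
  simp only [List.length_dropLast, Fintype.card_fin] at h
  simp only [Set.mem_ofPred_eq]
  omega

/-- `j` can be reached from `i` in `G`. -/
def DirGraph.Reach {V : Type} (G : DirGraph V) (i j : V) : Prop :=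
  Relation.ReflTransGen G.arc i j

/-- Every node of `G` can be reached from every other. -/
def DirGraph.StronglyConnected {V : Type} (G : DirGraph V) : Prop :=
  ∀ i ∈ G.nodes, ∀ j ∈ G.nodes, G.Reach i j

/-- The node sets of the strongly connected components of `G`. -/
def DirGraph.components {V : Type} (G : DirGraph V) : Set (Set V) :=
  {C | ∃ i ∈ G.nodes, C = {j | j ∈ G.nodes ∧ G.Reach i j ∧ G.Reach j i}}

/-- The subgraph of `G` induced on a set of nodes. -/
def DirGraph.induce {V : Type} (G : DirGraph V) (C : Set V) : DirGraph V where
  nodes := {i | i ∈ G.nodes ∧ i ∈ C}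
  arc := fun i j => G.arc i j ∧ i ∈ C ∧ j ∈ C
  left_mem := fun h => ⟨G.left_mem h.1, h.2.1⟩
  right_mem := fun h => ⟨G.right_mem h.1, h.2.2⟩

/-- The greatest common divisor of the lengths of the circuits of `G`
(with value `0`, the usual gcd of the empty set, if there is no circuit). -/
noncomputable def DirGraph.circuitGcd {V : Type} (G : DirGraph V) : ℕ :=
  sSup {d : ℕ | ∀ c, G.IsCircuit c → d ∣ len c}

open scoped Classical in
/-- The cyclicity of a graph: the gcd of the lengths of its circuits if it is strongly connected,
the lcm of the cyclicities of its strongly connected components otherwise. -/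
noncomputable def DirGraph.cyclicity {V : Type} [Finite V] (G : DirGraph V) : ℕ :=
  if G.StronglyConnected then G.circuitGcd
  else (Set.toFinite G.components).toFinset.lcm fun C => (G.induce C).circuitGcd

/-! ### The graph of a matrix, spectral radius, critical graph, type -/

/-- The graph of `A`: its arcs are the `(i,j)` such that `A i j > -∞`. -/
def graph {k : ℕ} (A : Mat k) : DirGraph (Fin k) where
  nodes := Set.univ
  arc := fun i j => A i j ≠ ⊥
  left_mem := fun _ => Set.mem_univ _
  right_mem := fun _ => Set.mem_univ _

/-- The weight of a path (it is `-∞` exactly if the path is not on the graph of `A`). -/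
noncomputable def weight {k : ℕ} (A : Mat k) (p : List (Fin k)) : Rmax :=
  ((arcs p).map fun a => A a.1 a.2).sum

/-- The average weight of a circuit (again `-∞` if it is not on the graph of `A`). -/
noncomputable def avgWeight {k : ℕ} (A : Mat k) (c : List (Fin k)) : Rmax :=
  (weight A c).map fun x => x / (len c : ℝ)

/-- The max-plus spectral radius: the maximum of the average weights of the elementary circuits.
Circuits that are not on the graph of `A` have average weight `-∞`, so they do not matter. -/
noncomputable def spectralRadius {k : ℕ} (A : Mat k) : Rmax :=
  (elemCircuits_finite k).toFinset.sup (avgWeight A)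

/-- `c` is a circuit on the graph of `A` whose average weight is the spectral radius. -/
def IsCriticalCircuit {k : ℕ} (A : Mat k) (c : List (Fin k)) : Prop :=
  (graph A).IsCircuit c ∧ avgWeight A c = spectralRadius A

theorem mem_of_mem_arcs {V : Type} {p : List V} {a : V × V} (h : a ∈ arcs p) :
    a.1 ∈ p ∧ a.2 ∈ p :=
  ⟨(List.of_mem_zip (a := a.1) (b := a.2) h).1,
    List.mem_of_mem_tail (List.of_mem_zip (a := a.1) (b := a.2) h).2⟩

/-- The critical graph of `A`: the nodes and arcs that belong to circuits of the graph of `A`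
whose average weight is the spectral radius. -/
def criticalGraph {k : ℕ} (A : Mat k) : DirGraph (Fin k) where
  nodes := {i | ∃ c, IsCriticalCircuit A c ∧ i ∈ c}
  arc := fun i j => ∃ c, IsCriticalCircuit A c ∧ (i, j) ∈ arcs c
  left_mem := fun ⟨c, hc, h⟩ => ⟨c, hc, (mem_of_mem_arcs h).1⟩
  right_mem := fun ⟨c, hc, h⟩ => ⟨c, hc, (mem_of_mem_arcs h).2⟩

/-- `A` has type scsN-cycC: its critical graph has `N` strongly connected components and its
cyclicity, that is, the cyclicity of its critical graph, is `C`. -/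
def HasType {k : ℕ} (A : Mat k) (N C : ℕ) : Prop :=
  (criticalGraph A).components.ncard = N ∧ (criticalGraph A).cyclicity = C

/-! ### Linear forms and hyperplanes -/

open scoped Classical in
/-- The linear form `f_α` on `Rmax ^ Q`. -/
noncomputable def linForm {Q : Type} [Fintype Q] (α : Q → ℝ) (v : Q → Rmax) : Rmax :=
  if ∀ q, α q ≠ 0 → v q ≠ ⊥ then ((∑ q, α q * (v q).unbotD 0 : ℝ) : Rmax) else ⊥

/-- The positions of the entries of a matrix. -/
abbrev Pos (k : ℕ) : Type := Fin k × Fin k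

/-- A pair of matrices as a vector indexed by the positions in the first and second matrix. -/
def entries {k : ℕ} (A B : Mat k) : Pos k ⊕ Pos k → Rmax :=
  Sum.elim (fun a => A a.1 a.2) (fun b => B b.1 b.2)

/-- The trace on `𝓟_k × 𝓜_k` of the set of zeros of the linear form `f_α`
(a hyperplane of `𝓟_k × 𝓜_k` if `α ≠ 0`). -/
def hyperplane {k : ℕ} (α : Pos k ⊕ Pos k → ℝ) : Set (Mat k × Mat k) :=
  {x | x.1 ∈ matP k ∧ x.2 ∈ matM k ∧ linForm α (entries x.1 x.2) = 0}

/-- The coefficients of the linear form `A ↦ w(A, p)`. -/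
def weightForm {k : ℕ} (p : List (Fin k)) : Pos k → ℝ :=
  fun a => ((arcs p).count a : ℝ)

/-- The coefficients of the linear form `A ↦ aw(A, c)`. -/
noncomputable def avgForm {k : ℕ} (c : List (Fin k)) : Pos k → ℝ :=
  fun a => weightForm c a / (len c : ℝ)

/-- `p` is an elementary path from `i` to `j` on the complete directed graph. -/
def IsElemPath {k : ℕ} (i j : Fin k) (p : List (Fin k)) : Prop :=
  (completeDirGraph (Fin k)).IsPathFromTo i j p ∧ IsElementary p

/-- The forms `aw(·, c₁) - aw(·, c₂)`, where `c₁`, `c₂` are elementary circuits that are different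
as directed graphs. -/
def formsE1 (k : ℕ) : Set (Pos k → ℝ) :=
  {α | ∃ c₁ ∈ elemCircuits k, ∃ c₂ ∈ elemCircuits k,
    (arcs c₁).toFinset ≠ (arcs c₂).toFinset ∧ α = avgForm c₁ - avgForm c₂}

/-- The forms `w(·, p₁) - |p₁| aw(·, c) - w(·, p₂) + |p₂| aw(·, c)`, where `p₁`, `p₂` are two
elementary paths from `i` to `κ ≠ i` and `c` is an elementary circuit through `κ`. -/
def formsE2 (k : ℕ) : Set (Pos k → ℝ) :=
  {α | ∃ (i κ : Fin k) (p₁ p₂ c : List (Fin k)), κ ≠ i ∧ IsElemPath i κ p₁ ∧ IsElemPath i κ p₂ ∧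
    p₁ ≠ p₂ ∧ c ∈ elemCircuits k ∧ κ ∈ c ∧
    α = weightForm p₁ - (len p₁ : ℝ) • avgForm c - weightForm p₂ + (len p₂ : ℝ) • avgForm c}

/-- The forms
`B(j₁,m₁) - B(j₂,m₂) + w(A,q₁) - w(A,p(i₁)) + w(A,p(m₁)) - w(A,q₂) + w(A,p(i₂)) - w(A,p(m₂))
  - (|q₁| - |p(i₁)| + |p(m₁)| - |q₂| + |p(i₂)| - |p(m₂)|) aw(A,p(κ))`,
where `m₁ ≠ m₂`, where `p(i)` is an elementary path from `i` to `κ` for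
`i ∈ {i₁, i₂, m₁, m₂, κ}`, and where `q_l` is a path from `i_l` to `j_l` of length at most
`|p(κ)| k`. -/
def formsE3 (k : ℕ) : Set (Pos k ⊕ Pos k → ℝ) :=
  {α | ∃ (i₁ i₂ j₁ j₂ m₁ m₂ κ : Fin k) (p : Fin k → List (Fin k)) (q₁ q₂ : List (Fin k)),
    m₁ ≠ m₂ ∧
    (∀ i ∈ ({i₁, i₂, m₁, m₂, κ} : Set (Fin k)), IsElemPath i κ (p i)) ∧
    (completeDirGraph (Fin k)).IsPathFromTo i₁ j₁ q₁ ∧ len q₁ ≤ len (p κ) * k ∧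
    (completeDirGraph (Fin k)).IsPathFromTo i₂ j₂ q₂ ∧ len q₂ ≤ len (p κ) * k ∧
    α = Sum.elim
      (weightForm q₁ - weightForm (p i₁) + weightForm (p m₁)
        - weightForm q₂ + weightForm (p i₂) - weightForm (p m₂)
        - ((len q₁ : ℝ) - len (p i₁) + len (p m₁) - len q₂ + len (p i₂) - len (p m₂)) •
          avgForm (p κ))
      (Pi.single (j₁, m₁) 1 - Pi.single (j₂, m₂) 1)}

/-- All the forms above, as linear forms of the pair `(A, B)`; those of the first two families
depend on `A` only. -/
def genericForms (k : ℕ) : Set (Pos k ⊕ Pos k → ℝ) :=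
  {α | (∃ β ∈ formsE1 k ∪ formsE2 k, α = Sum.elim β 0) ∨ α ∈ formsE3 k}

end MaxPlus

/-! Take an elementary circuit `c` of maximal average weight `ρ`, a node `κ` on it, and for each `i`
a path `P i` to `κ` without repeated nodes whose height, its weight minus `ρ` times its length, is
maximal. Replacing `A x y` by `A x y - ρ + height (P y) - height (P x)` makes every arc nonpositive
and every arc of `c` and of the `P i` zero. Genericity for the first two families makes the critical
circuit and the optimal paths unique, so at most one zero ("tight") arc leaves each node
(`exists_optimalPaths`, `tight_unique`). A walk of reduced weight zero is then determined by its
first node and its length.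

An entry of `A^m ⊗ B ⊗ A^n` is the best weight of a walk of length `m`, a jump through `B`, and a
walk of length `n`. For large `m`, a first walk that avoids `κ` is too expensive
(`exists_arcSum_le`). From `κ`, the best way to reach and cross `B` has a value `μ`, and the third
family forces every best jump to land at the same node `b` (`exists_optimalJump`). With `n = |P b| +
N |c|`, the only tight walk of length `n` from `b` ends at `κ`.

Up to a coboundary, all entries are therefore at most `r = μ + ρ (m + n)`, with equality only in
column `κ`, and the diagonal entry at `κ` attains `r`. Coboundaries cancel on circuits, so `r` is
the spectral radius and every critical arc ends at `κ` (`criticalGraph_nodes_eq`). -/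

namespace MaxPlus

/-! ### Walks -/

section Walks

variable {V : Type}

/-- `p` is the list of the nodes of a walk from `i` to `j` (possibly without any arc) all of whose
arcs satisfy `R`. -/
inductive IsWalk (R : V → V → Prop) : V → V → List V → Prop
  | single (i : V) : IsWalk R i i [i]
  | cons {i j l : V} {p : List V} : R i j → IsWalk R j l p → IsWalk R i l (i :: p)

/-- The sum of the real weights `e` over the arcs of `p`. -/
def arcSum (e : V → V → ℝ) (p : List V) : ℝ :=
  ((arcs p).map fun a => e a.1 a.2).sum

variable {R : V → V → Prop} {i j x y : V} {p q s t : List V}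

theorem arcs_cons_cons : arcs (x :: y :: p) = (x, y) :: arcs (y :: p) := rfl

theorem arcs_singleton : arcs [x] = [] := rfl

theorem map_fst_arcs : ∀ p : List V, (arcs p).map Prod.fst = p.dropLast
  | [] => rfl
  | [_] => rfl
  | x :: y :: p => by
    rw [arcs_cons_cons, List.map_cons, map_fst_arcs (y :: p), List.dropLast_cons_cons]

theorem map_snd_arcs : ∀ p : List V, (arcs p).map Prod.snd = p.tail
  | [] => rfl
  | [_] => rfl
  | x :: y :: p => by
    rw [arcs_cons_cons, List.map_cons, map_snd_arcs (y :: p)]; rfl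

theorem len_eq (p : List V) : len p = p.length - 1 := by
  rw [len, ← List.length_map (f := Prod.fst), map_fst_arcs, List.length_dropLast]

theorem arcs_append_cons (x : V) (t : List V) :
    ∀ s : List V, arcs (s ++ x :: t) = arcs (s ++ [x]) ++ arcs (x :: t)
  | [] => rfl
  | [_] => rfl
  | y :: z :: s => by
    have h := arcs_append_cons x t (z :: s)
    simp only [List.cons_append, arcs_cons_cons] at h ⊢
    rw [h]

theorem len_append_cons (x : V) (s t : List V) :
    len (s ++ x :: t) = len (s ++ [x]) + len (x :: t) := by
  rw [len, arcs_append_cons, List.length_append]; rfl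

theorem arcSum_append_cons (e : V → V → ℝ) (x : V) (s t : List V) :
    arcSum e (s ++ x :: t) = arcSum e (s ++ [x]) + arcSum e (x :: t) := by
  rw [arcSum, arcs_append_cons, List.map_append, List.sum_append]; rfl

theorem IsWalk.eq_cons (h : IsWalk R i j p) : ∃ t, p = i :: t := by
  cases h <;> exact ⟨_, rfl⟩

theorem IsWalk.eq_append (h : IsWalk R i j p) : ∃ s, p = s ++ [j] := by
  induction h with
  | single i => exact ⟨[], rfl⟩
  | cons _ _ ih => obtain ⟨s, rfl⟩ := ih; exact ⟨_ :: s, rfl⟩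

theorem IsWalk.head_mem (h : IsWalk R i j p) : i ∈ p := by
  obtain ⟨t, rfl⟩ := h.eq_cons; simp

theorem IsWalk.last_mem (h : IsWalk R i j p) : j ∈ p := by
  obtain ⟨s, rfl⟩ := h.eq_append; simp

theorem IsWalk.arcs_cons (h : IsWalk R i j p) (x : V) : arcs (x :: p) = (x, i) :: arcs p := by
  obtain ⟨t, rfl⟩ := h.eq_cons; rfl

theorem IsWalk.len_cons (h : IsWalk R i j p) (x : V) : len (x :: p) = len p + 1 := by
  rw [len, h.arcs_cons]; rfl

theorem IsWalk.arcSum_cons (h : IsWalk R i j p) (e : V → V → ℝ) (x : V) :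
    arcSum e (x :: p) = e x i + arcSum e p := by
  rw [arcSum, h.arcs_cons]; rfl

theorem IsWalk.arc (h : IsWalk R i j p) : ∀ a ∈ arcs p, R a.1 a.2 := by
  induction h with
  | single i => simp [arcs_singleton]
  | cons hR h ih =>
    rw [h.arcs_cons]
    rintro a (_ | ⟨_, ha⟩)
    exacts [hR, ih a ha]

theorem isWalk_of_arc : ∀ {p : List V} {i j : V}, p.head? = some i → p.getLast? = some j →
    (∀ a ∈ arcs p, R a.1 a.2) → IsWalk R i j p
  | [], _, _, h, _, _ => by simp at h
  | [x], i, j, h, h', _ => by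
    simp only [List.head?_cons, Option.some.injEq, List.getLast?_singleton] at h h'
    subst h h'
    exact .single _
  | x :: y :: p, i, j, h, h', ha => by
    simp only [List.head?_cons, Option.some.injEq] at h
    subst h
    rw [List.getLast?_cons_cons] at h'
    rw [arcs_cons_cons] at ha
    exact .cons (ha (x, y) (by simp)) (isWalk_of_arc rfl h' fun a h => ha a (by simp [h]))

theorem IsWalk.one_le_len (h : IsWalk R i j p) (hij : i ≠ j) : 1 ≤ len p := by
  cases h with
  | single => exact absurd rfl hij
  | cons _ h => rw [h.len_cons]; omega

theorem IsWalk.mono {S : V → V → Prop} (h : IsWalk R i j p) (hS : ∀ a ∈ arcs p, S a.1 a.2) :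
    IsWalk S i j p := by
  obtain ⟨t, ht⟩ := h.eq_cons
  obtain ⟨s, hs⟩ := h.eq_append
  exact isWalk_of_arc (by simp [ht]) (by simp [hs]) hS

theorem IsWalk.isPathFromTo (h : IsWalk R i j p) (hp : 1 ≤ len p) :
    (completeDirGraph V).IsPathFromTo i j p := by
  obtain ⟨t, ht⟩ := h.eq_cons
  obtain ⟨s, hs⟩ := h.eq_append
  exact ⟨⟨hp, fun _ _ => trivial⟩, by simp [ht], by simp [hs]⟩

theorem IsWalk.left (h : IsWalk R i j (s ++ x :: t)) : IsWalk R i x (s ++ [x]) := by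
  refine isWalk_of_arc ?_ (by simp) fun a ha => h.arc a ?_
  · obtain ⟨r, hr⟩ := h.eq_cons
    cases s <;> simp_all
  · rw [arcs_append_cons]; exact List.mem_append_left _ ha

theorem IsWalk.right (h : IsWalk R i j (s ++ x :: t)) : IsWalk R x j (x :: t) := by
  refine isWalk_of_arc (by simp) ?_ fun a ha => h.arc a ?_
  · obtain ⟨r, hr⟩ := h.eq_append
    have := congrArg List.getLast? hr
    simpa [List.getLast?_append] using this
  · rw [arcs_append_cons]; exact List.mem_append_right _ ha

theorem IsWalk.append {l : V} (h : IsWalk R i j p) (h' : IsWalk R j l q) :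
    ∃ r, IsWalk R i l r ∧ arcs r = arcs p ++ arcs q := by
  induction h with
  | single i => exact ⟨q, h', rfl⟩
  | cons hR h ih =>
    obtain ⟨r, hr, har⟩ := ih h'
    exact ⟨_, .cons hR hr, by rw [hr.arcs_cons, h.arcs_cons, har]; rfl⟩

theorem arcSum_of_arcs_eq {r : List V} (h : arcs r = arcs p ++ arcs q) (e : V → V → ℝ) :
    arcSum e r = arcSum e p + arcSum e q := by
  rw [arcSum, h, List.map_append, List.sum_append]; rfl

theorem len_of_arcs_eq {r : List V} (h : arcs r = arcs p ++ arcs q) :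
    len r = len p + len q := by
  rw [len, h, List.length_append]; rfl

theorem list_sum_nonpos {l : List ℝ} (h : ∀ r ∈ l, r ≤ 0) : l.sum ≤ 0 := by
  simpa using List.sum_le_card_nsmul l 0 h

theorem arcSum_nonpos {e : V → V → ℝ} (h : ∀ a ∈ arcs p, e a.1 a.2 ≤ 0) : arcSum e p ≤ 0 := by
  refine list_sum_nonpos fun r hr => ?_
  obtain ⟨a, ha, rfl⟩ := List.mem_map.1 hr
  exact h a ha

theorem IsWalk.arcSum_nonpos {e : V → V → ℝ} (he : ∀ x y, R x y → e x y ≤ 0)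
    (h : IsWalk R i j p) : arcSum e p ≤ 0 :=
  MaxPlus.arcSum_nonpos fun a ha => he _ _ (h.arc a ha)

/-- A walk without gain can be made free of repeated nodes. -/
theorem IsWalk.exists_nodup {e : V → V → ℝ} (he : ∀ x y, R x y → e x y ≤ 0)
    (h : IsWalk R i j p) : ∃ q, IsWalk R i j q ∧ q.Nodup ∧ arcSum e p ≤ arcSum e q := by
  induction h with
  | single i => exact ⟨[i], .single i, by simp, le_rfl⟩
  | @cons i j l p hR h ih =>
    obtain ⟨q, hq, hn, hle⟩ := ih
    rw [h.arcSum_cons]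
    by_cases hi : i ∈ q
    -- The walk returns to `i`: the closed part between the two visits has nonpositive weight and is
    -- cut out.
    · obtain ⟨s, t, rfl⟩ := List.append_of_mem hi
      refine ⟨i :: t, hq.right, hn.sublist (List.sublist_append_right _ _), ?_⟩
      rw [arcSum_append_cons] at hle
      linarith [he _ _ hR, hq.left.arcSum_nonpos he]
    · refine ⟨i :: q, .cons hR hq, List.nodup_cons.2 ⟨hi, hn⟩, ?_⟩
      rw [hq.arcSum_cons]
      linarith

/-- Adding a constant and a coboundary to the weights. -/
theorem IsWalk.arcSum_add_coboundary (h : IsWalk R i j p) (e : V → V → ℝ) (ρ : ℝ) (u : V → ℝ) :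
    arcSum (fun x y => e x y - ρ + u y - u x) p = arcSum e p - ρ * len p + u j - u i := by
  induction h with
  | single i => simp [arcSum, len, arcs_singleton]
  | cons hR h ih =>
    rw [h.arcSum_cons, h.arcSum_cons, h.len_cons, ih]
    push_cast
    ring

/-- Upper bound of the weight of a walk from a bound of the weights of its arcs by a constant and
a coboundary. -/
theorem IsWalk.arcSum_le (h : IsWalk R i j p) {e : V → V → ℝ} {r : ℝ} {u : V → ℝ}
    (he : ∀ a ∈ arcs p, e a.1 a.2 ≤ r + u a.1 - u a.2) :
    arcSum e p ≤ r * len p + u i - u j := by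
  have h1 := h.arcSum_add_coboundary e r u
  have h2 : arcSum (fun x y => e x y - r + u y - u x) p ≤ 0 :=
    MaxPlus.arcSum_nonpos fun a ha => by linarith [he a ha]
  linarith

theorem eq_zero_of_arcSum_eq_zero {e : V → V → ℝ} (he : ∀ a ∈ arcs p, e a.1 a.2 ≤ 0)
    (h : arcSum e p = 0) : ∀ a ∈ arcs p, e a.1 a.2 = 0 := by
  intro a ha
  obtain ⟨s, t, hst⟩ := List.append_of_mem ha
  rw [hst] at he
  rw [arcSum, hst, List.map_append, List.sum_append, List.map_cons, List.sum_cons] at h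
  have hs : (s.map fun a => e a.1 a.2).sum ≤ 0 := list_sum_nonpos fun r hr => by
    obtain ⟨b, hb, rfl⟩ := List.mem_map.1 hr
    exact he b (by simp [hb])
  have ht : (t.map fun a => e a.1 a.2).sum ≤ 0 := list_sum_nonpos fun r hr => by
    obtain ⟨b, hb, rfl⟩ := List.mem_map.1 hr
    exact he b (by simp [hb])
  have := he a (by simp)
  linarith

/-- In a graph with at most one arc out of each node, the walks from a node are determined by
their length. -/
theorem IsWalk.eq_of_unique {j' : V} {q : List V} (hR : ∀ x y y', R x y → R x y' → y = y')
    (h : IsWalk R i j p) (h' : IsWalk R i j' q) (hl : len p = len q) : j = j' ∧ p = q := by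
  induction h generalizing j' q with
  | single i =>
    cases h' with
    | single => exact ⟨rfl, rfl⟩
    | cons _ h' => rw [h'.len_cons] at hl; simp [len, arcs_singleton] at hl
  | cons hij h ih =>
    cases h' with
    | single => rw [h.len_cons] at hl; simp [len, arcs_singleton] at hl
    | cons hij' h' =>
      obtain rfl := hR _ _ _ hij hij'
      rw [h.len_cons, h'.len_cons] at hl
      obtain ⟨rfl, rfl⟩ := ih h' (by omega)
      exact ⟨rfl, rfl⟩

/-- Running several times around a closed walk. -/
theorem IsWalk.iterate (h : IsWalk R i i p) (e : V → V → ℝ) (n : ℕ) :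
    ∃ q, IsWalk R i i q ∧ len q = n * len p ∧ arcSum e q = n * arcSum e p := by
  induction n with
  | zero => exact ⟨[i], .single i, by simp [len, arcs_singleton], by simp [arcSum, arcs_singleton]⟩
  | succ n ih =>
    obtain ⟨q, hq, hl, hs⟩ := ih
    obtain ⟨r, hr, ha⟩ := hq.append h
    refine ⟨r, hr, ?_, ?_⟩
    · rw [len_of_arcs_eq ha, hl]; ring
    · rw [arcSum_of_arcs_eq ha, hs]; push_cast; ring

theorem IsElementary.of_nodup (h : p.Nodup) : IsElementary p :=
  ⟨h.sublist (List.dropLast_sublist _), h.sublist (List.tail_sublist _)⟩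

/-- Closing a path by an arc from its last node back to its first is how all elementary circuits
below are built. -/
theorem IsElementary.cons_of_nodup (h : IsWalk R i j p) (hn : p.Nodup) :
    IsElementary (j :: p) := by
  obtain ⟨s, rfl⟩ := h.eq_append
  refine ⟨?_, hn⟩
  rw [List.nodup_append] at hn
  rw [← List.cons_append, List.dropLast_concat, List.nodup_cons]
  exact ⟨fun hj => hn.2.2 j hj j (by simp) rfl, hn.1⟩

theorem arc_fst_inj (h : p.dropLast.Nodup) (hx : (i, x) ∈ arcs p) (hy : (i, y) ∈ arcs p) :
    x = y := by
  rw [← map_fst_arcs] at h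
  have := List.inj_on_of_nodup_map h hx hy rfl
  simpa using this

theorem exists_arc_of_mem_dropLast (h : i ∈ p.dropLast) : ∃ x, (i, x) ∈ arcs p := by
  rw [← map_fst_arcs] at h
  simpa using h

end Walks

variable {k : ℕ}

/-! ### Entries, weights and products -/

/-- The entries of a matrix as real numbers, with `-∞` replaced by `0`. -/
noncomputable def ent (A : Mat k) (i j : Fin k) : ℝ :=
  (A i j).unbotD 0

/-- The arcs of the graph of a matrix. -/
def Arc (A : Mat k) (i j : Fin k) : Prop :=
  A i j ≠ ⊥

theorem coe_ent {A : Mat k} {i j : Fin k} (h : A i j ≠ ⊥) : (ent A i j : Rmax) = A i j := by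
  obtain ⟨r, hr⟩ := WithBot.ne_bot_iff_exists.1 h
  simp [ent, ← hr]

theorem weight_eq {A : Mat k} {p : List (Fin k)} (h : ∀ a ∈ arcs p, A a.1 a.2 ≠ ⊥) :
    weight A p = (arcSum (ent A) p : ℝ) := by
  unfold weight arcSum
  generalize arcs p = l at h
  induction l with
  | nil => rfl
  | cons a l ih =>
    rw [List.map_cons, List.sum_cons, List.map_cons, List.sum_cons,
      ih fun b hb => h b (by simp [hb]), WithBot.coe_add, coe_ent (h a (by simp))]

theorem avgWeight_eq {A : Mat k} {p : List (Fin k)} (h : ∀ a ∈ arcs p, A a.1 a.2 ≠ ⊥) :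
    avgWeight A p = ((arcSum (ent A) p / len p : ℝ) : Rmax) := by
  rw [avgWeight, weight_eq h]; rfl

theorem add_le_mul (A B : Mat k) (i l j : Fin k) : A i l + B l j ≤ mul A B i j :=
  Finset.le_sup (f := fun l => A i l + B l j) (Finset.mem_univ l)

theorem exists_mul_eq (A B : Mat k) (i j : Fin k) : ∃ l, mul A B i j = A i l + B l j := by
  obtain ⟨l, -, hl⟩ := Finset.exists_mem_eq_sup Finset.univ ⟨i, Finset.mem_univ i⟩
    fun l => A i l + B l j
  exact ⟨l, hl⟩

theorem mul_ne_bot {A B : Mat k} {i l j : Fin k} (hA : A i l ≠ ⊥) (hB : B l j ≠ ⊥) :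
    mul A B i j ≠ ⊥ := by
  intro h
  have := add_le_mul A B i l j
  rw [h, le_bot_iff, WithBot.add_eq_bot] at this
  tauto

/-- The entries of powers bound the weights of walks. -/
theorem IsWalk.le_pow {A : Mat k} {n : ℕ} {i j : Fin k} {p : List (Fin k)}
    (h : IsWalk (Arc A) i j p) (hn : len p = n) : (arcSum (ent A) p : Rmax) ≤ pow A n i j := by
  induction n generalizing p j with
  | zero =>
    cases h with
    | single => simp [arcSum, arcs_singleton, pow, one]
    | cons _ h => rw [h.len_cons] at hn; omega
  | succ n ih =>
    obtain ⟨s, rfl⟩ := h.eq_append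
    rcases List.eq_nil_or_concat s with rfl | ⟨s, x, rfl⟩
    · simp [len, arcs_singleton] at hn
    · rw [List.concat_eq_append, List.append_assoc, List.singleton_append] at h hn ⊢
      have hr := h.right
      have hx : Arc A x j := hr.arc (x, j) (by simp [arcs_cons_cons])
      rw [len_append_cons] at hn
      rw [arcSum_append_cons, WithBot.coe_add]
      refine le_trans (add_le_add (ih h.left ?_) ?_) (add_le_mul _ _ i x j)
      · simpa [len, arcs_cons_cons, arcs_singleton] using hn
      · simp [arcSum, arcs_cons_cons, arcs_singleton, coe_ent hx]

/-- The finite entries of powers are weights of walks. -/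
theorem exists_isWalk_of_pow {A : Mat k} {n : ℕ} {i j : Fin k} (h : pow A n i j ≠ ⊥) :
    ∃ p, IsWalk (Arc A) i j p ∧ len p = n ∧ pow A n i j = (arcSum (ent A) p : Rmax) := by
  induction n generalizing j with
  | zero =>
    by_cases hij : i = j
    · subst hij
      exact ⟨[i], .single i, rfl, by simp [arcSum, arcs_singleton, pow, one]⟩
    · simp [pow, one, hij] at h
  | succ n ih =>
    obtain ⟨l, hl⟩ := exists_mul_eq (pow A n) A i j
    have hl' : pow A (n + 1) i j = pow A n i l + A l j := hl
    rw [hl', ne_eq, WithBot.add_eq_bot, not_or] at h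
    obtain ⟨p, hp, hpn, hpw⟩ := ih h.1
    have hq : IsWalk (Arc A) l j [l, j] := .cons h.2 (.single j)
    obtain ⟨r, hr, har⟩ := hp.append hq
    refine ⟨r, hr, by rw [len_of_arcs_eq har, hpn]; rfl, ?_⟩
    rw [hl', hpw, arcSum_of_arcs_eq har, WithBot.coe_add]
    simp [arcSum, arcs_cons_cons, arcs_singleton, coe_ent h.2]

theorem exists_pow_ne_bot {A : Mat k} (hA : A ∈ matM k) (n : ℕ) (i : Fin k) :
    ∃ j, pow A n i j ≠ ⊥ := by
  induction n with
  | zero => exact ⟨i, by simp [pow, one]⟩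
  | succ n ih =>
    obtain ⟨l, hl⟩ := ih
    obtain ⟨j, hj⟩ := hA l
    exact ⟨j, mul_ne_bot hl hj⟩

/-- Powers of a primitive matrix are eventually finite. -/
theorem exists_forall_hasFiniteEntries {A : Mat k} (hA : A ∈ matP k) :
    ∃ N, ∀ n, N ≤ n → HasFiniteEntries (pow A n) := by
  obtain ⟨hM, N, hN⟩ := hA
  refine ⟨N, fun n hn => ?_⟩
  induction n, hn using Nat.le_induction with
  | base => exact hN
  | succ n _ ih =>
    intro i j
    obtain ⟨l, hl⟩ := hM i
    obtain ⟨p, hp, hpn, -⟩ := exists_isWalk_of_pow (ih l j)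
    have h := (IsWalk.cons (R := Arc A) hl hp).le_pow (n := n + 1) (by rw [hp.len_cons, hpn])
    exact fun h' => by simp [h'] at h

theorem exists_isWalk {A : Mat k} (hA : A ∈ matP k) (i j : Fin k) :
    ∃ p, IsWalk (Arc A) i j p ∧ p.Nodup := by
  obtain ⟨-, n, hn⟩ := hA
  obtain ⟨p, hp, -, -⟩ := exists_isWalk_of_pow (hn i j)
  -- With zero weights only the removal of repeated nodes remains.
  obtain ⟨q, hq, hn, -⟩ := hp.exists_nodup (e := 0) fun _ _ _ => le_rfl
  exact ⟨q, hq, hn⟩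

/-! ### Evaluation of linear forms -/

/-- The value at `A` of the linear form with coefficients `β`. -/
noncomputable def evalForm (A : Mat k) (β : Pos k → ℝ) : ℝ :=
  ∑ a, β a * ent A a.1 a.2

section

variable (A : Mat k) (β γ : Pos k → ℝ)

theorem evalForm_add : evalForm A (β + γ) = evalForm A β + evalForm A γ := by
  simp [evalForm, add_mul, Finset.sum_add_distrib]

theorem evalForm_sub : evalForm A (β - γ) = evalForm A β - evalForm A γ := by
  simp [evalForm, sub_mul, Finset.sum_sub_distrib]

theorem evalForm_smul (r : ℝ) : evalForm A (r • β) = r * evalForm A β := by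
  simp [evalForm, mul_assoc, Finset.mul_sum]

theorem evalForm_zero : evalForm A 0 = 0 := by
  simp [evalForm]

theorem evalForm_single (a : Pos k) : evalForm A (Pi.single a 1) = ent A a.1 a.2 := by
  classical simp [evalForm, Pi.single_apply]

theorem evalForm_weightForm (p : List (Fin k)) : evalForm A (weightForm p) = arcSum (ent A) p := by
  unfold evalForm weightForm arcSum
  generalize arcs p = l
  induction l with
  | nil => simp
  | cons a l ih =>
    rw [List.map_cons, List.sum_cons, ← ih]
    simp [List.count_cons, add_mul, Finset.sum_add_distrib, add_comm]

theorem evalForm_avgForm (p : List (Fin k)) :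
    evalForm A (avgForm p) = arcSum (ent A) p / len p := by
  rw [← evalForm_weightForm, evalForm, evalForm, Finset.sum_div]
  exact Finset.sum_congr rfl fun a _ => by rw [avgForm]; ring

end

theorem weightForm_eq_zero {p : List (Fin k)} {a : Pos k} (h : a ∉ arcs p) :
    weightForm p a = 0 := by
  simp [weightForm, List.count_eq_zero_of_not_mem h]

theorem weightForm_pos {p : List (Fin k)} {a : Pos k} (h : a ∈ arcs p) :
    0 < weightForm p a := by
  simpa [weightForm, List.count_pos_iff] using h

theorem avgForm_eq_zero {p : List (Fin k)} {a : Pos k} (h : a ∉ arcs p) :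
    avgForm p a = 0 := by
  simp [avgForm, weightForm_eq_zero h]

theorem avgForm_pos {p : List (Fin k)} {a : Pos k} (h : a ∈ arcs p) :
    0 < avgForm p a :=
  div_pos (weightForm_pos h) (Nat.cast_pos.2 (List.length_pos_of_mem h))

/-- The infinite entries carry zero coefficients, so the form takes its finite branch and the
default value `0` of `ent` is harmless. -/
theorem linForm_entries {A B : Mat k} {β γ : Pos k → ℝ} (hβ : ∀ a, A a.1 a.2 = ⊥ → β a = 0)
    (hγ : ∀ a, B a.1 a.2 = ⊥ → γ a = 0) :
    linForm (Sum.elim β γ) (entries A B) = ((evalForm A β + evalForm B γ : ℝ) : Rmax) := by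
  rw [linForm, if_pos]
  · simp [evalForm, entries, ent]
  · rintro (a | a) h
    · exact fun h' => h (hβ a h')
    · exact fun h' => h (hγ a h')

/-! ### Consequences of genericity, one for each family of forms -/

/-- The pair `(A, B)` is on none of the hyperplanes. -/
def IsGeneric (A B : Mat k) : Prop :=
  ∀ α ∈ genericForms k, linForm α (entries A B) ≠ 0

theorem IsWalk.weightForm_eq_zero {A : Mat k} {i j : Fin k} {p : List (Fin k)}
    (h : IsWalk (Arc A) i j p) {a : Pos k} (ha : A a.1 a.2 = ⊥) : weightForm p a = 0 :=
  MaxPlus.weightForm_eq_zero fun h' => h.arc a h' ha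

theorem IsWalk.avgForm_eq_zero {A : Mat k} {i j : Fin k} {p : List (Fin k)}
    (h : IsWalk (Arc A) i j p) {a : Pos k} (ha : A a.1 a.2 = ⊥) : avgForm p a = 0 :=
  MaxPlus.avgForm_eq_zero fun h' => h.arc a h' ha

theorem IsWalk.mem_elemCircuits {R : Fin k → Fin k → Prop} {i : Fin k} {c : List (Fin k)}
    (h : IsWalk R i i c) (hl : 1 ≤ len c) (he : IsElementary c) : c ∈ elemCircuits k := by
  have := h.isPathFromTo hl
  exact ⟨⟨this.1, this.2.1.trans this.2.2.symm⟩, he⟩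

/-- Otherwise the form of `formsE1` attached to `c` and `d` would vanish. Applied to maximal
circuits, this gives uniqueness of the critical circuit. -/
theorem IsGeneric.arcs_eq {A B : Mat k} (hG : IsGeneric A B) {i j : Fin k} {c d : List (Fin k)}
    (hc : IsWalk (Arc A) i i c) (hcl : 1 ≤ len c) (hce : IsElementary c)
    (hd : IsWalk (Arc A) j j d) (hdl : 1 ≤ len d) (hde : IsElementary d)
    (h : arcSum (ent A) c / len c = arcSum (ent A) d / len d) (a : Pos k) :
    a ∈ arcs c ↔ a ∈ arcs d := by
  by_contra hne
  refine hG (Sum.elim (avgForm c - avgForm d) 0) (.inl ⟨_, .inl ⟨c, hc.mem_elemCircuits hcl hce, d,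
    hd.mem_elemCircuits hdl hde, fun h => hne ?_, rfl⟩, rfl⟩) ?_
  · simpa using Finset.ext_iff.1 h a
  · rw [linForm_entries (fun a ha => by simp [hc.avgForm_eq_zero ha, hd.avgForm_eq_zero ha])
      (γ := 0) fun _ _ => rfl, evalForm_sub, evalForm_zero, evalForm_avgForm, evalForm_avgForm, h]
    simp

/-- Otherwise a form of `formsE2` would vanish. This gives uniqueness of the optimal path to `κ`. -/
theorem IsGeneric.path_eq {A B : Mat k} (hG : IsGeneric A B) {i κ l : Fin k}
    {p q c : List (Fin k)} (hc : IsWalk (Arc A) l l c) (hcl : 1 ≤ len c) (hce : IsElementary c)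
    (hκ : κ ∈ c) (hi : κ ≠ i) (hp : IsWalk (Arc A) i κ p) (hpn : p.Nodup)
    (hq : IsWalk (Arc A) i κ q) (hqn : q.Nodup)
    (h : arcSum (ent A) p - arcSum (ent A) c / len c * len p =
      arcSum (ent A) q - arcSum (ent A) c / len c * len q) : p = q := by
  by_contra hne
  refine hG (Sum.elim _ 0) (.inl ⟨_, .inr ⟨i, κ, p, q, c, hi,
    ⟨hp.isPathFromTo (hp.one_le_len hi.symm), .of_nodup hpn⟩, ⟨hq.isPathFromTo (hq.one_le_len hi.symm), .of_nodup hqn⟩, hne,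
    hc.mem_elemCircuits hcl hce, hκ, rfl⟩, rfl⟩) ?_
  rw [linForm_entries (fun a ha => by
      simp [hc.avgForm_eq_zero ha, hp.weightForm_eq_zero ha, hq.weightForm_eq_zero ha])
      (γ := 0) fun _ _ => rfl, evalForm_add, evalForm_sub, evalForm_sub, evalForm_smul, evalForm_smul,
      evalForm_zero, evalForm_weightForm, evalForm_weightForm, evalForm_avgForm]
  norm_cast
  linarith

/-- Only the forms of `formsE3` with `i₁ = i₂ = κ` are needed; in them the two terms in `p κ`
cancel. -/
theorem IsGeneric.target_eq {A B : Mat k} (hG : IsGeneric A B) {κ j₁ j₂ m₁ m₂ : Fin k}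
    {c q₁ q₂ : List (Fin k)} {P : Fin k → List (Fin k)}
    (hc : IsWalk (Arc A) κ κ c) (hcl : 1 ≤ len c) (hce : IsElementary c)
    (hP : ∀ i, IsWalk (Arc A) i κ (P i)) (hPn : ∀ i, (P i).Nodup) (hPκ : P κ = [κ])
    (hq₁ : IsWalk (Arc A) κ j₁ q₁) (hl₁ : 1 ≤ len q₁) (hk₁ : len q₁ ≤ k)
    (hq₂ : IsWalk (Arc A) κ j₂ q₂) (hl₂ : 1 ≤ len q₂) (hk₂ : len q₂ ≤ k)
    (hB₁ : B j₁ m₁ ≠ ⊥) (hB₂ : B j₂ m₂ ≠ ⊥)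
    (h : ent B j₁ m₁ + (arcSum (ent A) q₁ - arcSum (ent A) c / len c * len q₁) +
        (arcSum (ent A) (P m₁) - arcSum (ent A) c / len c * len (P m₁)) =
      ent B j₂ m₂ + (arcSum (ent A) q₂ - arcSum (ent A) c / len c * len q₂) +
        (arcSum (ent A) (P m₂) - arcSum (ent A) c / len c * len (P m₂))) : m₁ = m₂ := by
  by_contra hne
  -- The forms require paths with at least one arc, which `[κ]` lacks. The circuit `c` replaces it:
  -- after subtracting the mean for each arc, both have weight zero.
  set p : Fin k → List (Fin k) := fun i => if i = κ then c else P i with hp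
  have hpw : ∀ i, IsWalk (Arc A) i κ (p i) := by
    intro i
    by_cases hi : i = κ
    · subst hi; simpa [hp] using hc
    · simpa [hp, hi] using hP i
  have hpe : ∀ i, IsElemPath i κ (p i) := by
    intro i
    by_cases hi : i = κ
    · subst hi; simpa [hp] using ⟨hc.isPathFromTo hcl, hce⟩
    · refine ⟨(hpw i).isPathFromTo ((hpw i).one_le_len hi), ?_⟩
      simpa [hp, hi] using IsElementary.of_nodup (hPn i)
  have hκ : p κ = c := by simp [hp]
  have hpv : ∀ i, arcSum (ent A) (p i) - arcSum (ent A) c / len c * len (p i) =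
      arcSum (ent A) (P i) - arcSum (ent A) c / len c * len (P i) := by
    intro i
    by_cases hi : i = κ
    · subst hi
      have : (len c : ℝ) ≠ 0 := by positivity
      rw [hκ, hPκ, div_mul_cancel₀ _ this]
      simp [arcSum, len, arcs_singleton]
    · simp [hp, hi]
  have hck : k ≤ len (p κ) * k := by
    rw [hκ]; exact Nat.le_mul_of_pos_left _ hcl
  refine hG _ (.inr ⟨κ, κ, j₁, j₂, m₁, m₂, κ, p, q₁, q₂, hne, fun i _ => hpe i,
    hq₁.isPathFromTo hl₁, hk₁.trans hck, hq₂.isPathFromTo hl₂, hk₂.trans hck, rfl⟩) ?_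
  rw [linForm_entries (fun a ha => by
      simp [(hpw _).avgForm_eq_zero ha, (hpw _).weightForm_eq_zero ha, hq₁.weightForm_eq_zero ha,
        hq₂.weightForm_eq_zero ha]) (fun a ha => by
      have h₁ : a ≠ (j₁, m₁) := fun h => hB₁ (by rw [← ha, h])
      have h₂ : a ≠ (j₂, m₂) := fun h => hB₂ (by rw [← ha, h])
      simp [h₁, h₂])]
  simp only [evalForm_add, evalForm_sub, evalForm_smul, evalForm_weightForm, evalForm_avgForm,
    evalForm_single]
  rw [hκ]
  norm_cast
  have h₁ := hpv m₁
  have h₂ := hpv m₂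
  push_cast
  linarith

/-! ### Optimal paths to a critical node -/

/-- The weight of a path, normalised by `ρ` for each arc. -/
noncomputable def height (A : Mat k) (ρ : ℝ) (p : List (Fin k)) : ℝ :=
  arcSum (ent A) p - ρ * len p

theorem height_singleton (A : Mat k) (ρ : ℝ) (x : Fin k) : height A ρ [x] = 0 := by
  simp [height, arcSum, len, arcs_singleton]

theorem height_append_cons (A : Mat k) (ρ : ℝ) (x : Fin k) (s t : List (Fin k)) :
    height A ρ (s ++ x :: t) = height A ρ (s ++ [x]) + height A ρ (x :: t) := by
  rw [height, height, height, arcSum_append_cons, len_append_cons]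
  push_cast
  ring

theorem IsWalk.height_cons {R : Fin k → Fin k → Prop} {i j : Fin k} {p : List (Fin k)}
    (h : IsWalk R i j p) (A : Mat k) (ρ : ℝ) (x : Fin k) :
    height A ρ (x :: p) = ent A x i - ρ + height A ρ p := by
  rw [height, height, h.arcSum_cons, h.len_cons]
  push_cast
  ring

/-- The entries of `A`, normalised by `ρ` and the heights of the paths `P`. -/
noncomputable def reduced (A : Mat k) (ρ : ℝ) (P : Fin k → List (Fin k)) (x y : Fin k) : ℝ :=
  ent A x y - ρ + height A ρ (P y) - height A ρ (P x)

/-- The arcs of the graph of `A` whose reduced weight vanishes. -/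
def Tight (A : Mat k) (ρ : ℝ) (P : Fin k → List (Fin k)) (x y : Fin k) : Prop :=
  Arc A x y ∧ reduced A ρ P x y = 0

/-- `c` is a circuit from `κ` of average weight `ρ`, and the `P i` are paths to `κ` whose reduced
weights are nonpositive, in such a way that the graph of the arcs of reduced weight zero has only
one arc out of each node. -/
structure OptimalPaths (A : Mat k) (ρ : ℝ) (κ : Fin k) (c : List (Fin k))
    (P : Fin k → List (Fin k)) : Prop where
  circuit : IsWalk (Arc A) κ κ c
  one_le_len : 1 ≤ len c
  elementary : IsElementary c
  mean : ρ = arcSum (ent A) c / len c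
  isWalk : ∀ i, IsWalk (Arc A) i κ (P i)
  nodup : ∀ i, (P i).Nodup
  path_self : P κ = [κ]
  reduced_nonpos : ∀ x y, Arc A x y → reduced A ρ P x y ≤ 0
  path_of_tight : ∀ x y, Tight A ρ P x y → x ≠ κ → P x = x :: P y
  unique_of_tight : ∀ y y', Tight A ρ P κ y → Tight A ρ P κ y' → y = y'

theorem exists_max_circuit (hk : 0 < k) {A : Mat k} (hA : A ∈ matP k) :
    ∃ (κ : Fin k) (c : List (Fin k)), IsWalk (Arc A) κ κ c ∧ 1 ≤ len c ∧ IsElementary c ∧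
      ∀ i d, IsWalk (Arc A) i i d → 1 ≤ len d → IsElementary d →
        height A (arcSum (ent A) c / len c) d ≤ 0 := by
  let S : Set (List (Fin k)) := {c | ∃ i, IsWalk (Arc A) i i c ∧ 1 ≤ len c ∧ IsElementary c}
  have hS : S.Finite := (elemCircuits_finite k).subset fun c ⟨i, h, hl, he⟩ =>
    h.mem_elemCircuits hl he
  have hne : S.Nonempty := by
    obtain ⟨j, hj⟩ := hA.1 ⟨0, hk⟩
    obtain ⟨p, hp, hn⟩ := exists_isWalk hA j ⟨0, hk⟩
    -- An arc out of node `0`, closed by a path back to it.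
    exact ⟨_, _, .cons hj hp, by rw [hp.len_cons]; omega, .cons_of_nodup hp hn⟩
  obtain ⟨c, ⟨κ, hc, hl, he⟩, hmax⟩ := hS.exists_maximalFor
    (fun c => arcSum (ent A) c / len c) S hne
  refine ⟨κ, c, hc, hl, he, fun i d hd hdl hde => ?_⟩
  have h : arcSum (ent A) d / len d ≤ arcSum (ent A) c / len c := by
    by_contra! h
    exact absurd (hmax ⟨i, hd, hdl, hde⟩ h.le) (not_le.2 h)
  rw [div_le_iff₀ (by exact_mod_cast hdl)] at h
  rw [height]
  linarith

theorem exists_max_path {A : Mat k} (hA : A ∈ matP k) (ρ : ℝ) (i κ : Fin k) :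
    ∃ p, (IsWalk (Arc A) i κ p ∧ p.Nodup) ∧
      ∀ q, IsWalk (Arc A) i κ q → q.Nodup → height A ρ q ≤ height A ρ p := by
  let S : Set (List (Fin k)) := {p | IsWalk (Arc A) i κ p ∧ p.Nodup}
  have hS : S.Finite := (List.finite_length_le (Fin k) k).subset fun p hp => by
    simpa using hp.2.length_le_card
  obtain ⟨p, hp, hmax⟩ := hS.exists_maximalFor (height A ρ) S (exists_isWalk hA i κ)
  exact ⟨p, hp, fun q hq hn => (le_total _ _).elim id (hmax ⟨hq, hn⟩)⟩

/-- For an arc `x → y`, the list `x :: P y` either competes with `P x`, or repeats `x` and splits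
into an elementary circuit and a path from `x` to `κ`. Maximality of `ρ` and of `P x` bounds the
reduced weight in both cases, and genericity settles equality. -/
theorem exists_optimalPaths (hk : 0 < k) {A B : Mat k} (hA : A ∈ matP k) (hG : IsGeneric A B) :
    ∃ ρ κ c P, OptimalPaths A ρ κ c P := by
  obtain ⟨κ, c, hc, hcl, hce, hmax⟩ := exists_max_circuit hk hA
  set ρ := arcSum (ent A) c / len c with hρ
  choose P hP hPmax using fun i => exists_max_path hA ρ i κ
  have hsplit : ∀ x y s t, Arc A x y → P y = s ++ x :: t →
      IsWalk (Arc A) x x (x :: (s ++ [x])) ∧ 1 ≤ len (x :: (s ++ [x])) ∧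
        IsElementary (x :: (s ++ [x])) ∧ κ ∉ s ∧ IsWalk (Arc A) x κ (x :: t) ∧ (x :: t).Nodup ∧
        reduced A ρ P x y + height A ρ (P x) =
          height A ρ (x :: (s ++ [x])) + height A ρ (x :: t) := by
    intro x y s t hxy hs
    have hw := (hP y).1
    have hn := (hP y).2
    rw [hs] at hw hn
    have hl := hw.left
    have hκ := hw.right.last_mem
    refine ⟨.cons hxy hl, by rw [hl.len_cons]; omega, .cons_of_nodup hl ?_, ?_, hw.right,
      hn.sublist (List.sublist_append_right _ _), ?_⟩
    · refine hn.sublist (List.Sublist.append_left ?_ _)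
      simp
    · exact fun h => (List.nodup_append.1 hn).2.2 κ h κ hκ rfl
    · rw [hl.height_cons, reduced, hs, height_append_cons]
      ring
  have hcons : ∀ x y, x ∉ P y → Arc A x y →
      IsWalk (Arc A) x κ (x :: P y) ∧ (x :: P y).Nodup ∧
        reduced A ρ P x y + height A ρ (P x) = height A ρ (x :: P y) := by
    intro x y hx hxy
    refine ⟨.cons hxy (hP y).1, List.nodup_cons.2 ⟨hx, (hP y).2⟩, ?_⟩
    rw [(hP y).1.height_cons, reduced]
    ring
  have hmean : ∀ i d, IsWalk (Arc A) i i d → 1 ≤ len d → IsElementary d → height A ρ d = 0 →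
      ∀ a, a ∈ arcs c ↔ a ∈ arcs d := by
    intro i d hd hdl hde h
    refine hG.arcs_eq hc hcl hce hd hdl hde ?_
    have : (len d : ℝ) ≠ 0 := by positivity
    rw [height] at h
    rw [eq_div_iff this, ← hρ]
    linarith
  have hself : P κ = [κ] := by
    obtain ⟨h, hn⟩ := hP κ
    generalize P κ = p at h hn
    cases h with
    | single => rfl
    | cons _ h => exact absurd h.last_mem (List.nodup_cons.1 hn).1
  refine ⟨ρ, κ, c, P, hc, hcl, hce, hρ, fun i => (hP i).1, fun i => (hP i).2, hself, ?_, ?_, ?_⟩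
  · intro x y hxy
    by_cases hx : x ∈ P y
    · obtain ⟨s, t, hs⟩ := List.append_of_mem hx
      obtain ⟨h₁, h₂, h₃, -, h₄, h₅, h₆⟩ := hsplit x y s t hxy hs
      linarith [hmax _ _ h₁ h₂ h₃, hPmax _ _ h₄ h₅]
    · obtain ⟨h₁, h₂, h₃⟩ := hcons x y hx hxy
      linarith [hPmax _ _ h₁ h₂]
  · rintro x y ⟨hxy, h0⟩ hxκ
    by_cases hx : x ∈ P y
    · obtain ⟨s, t, hs⟩ := List.append_of_mem hx
      obtain ⟨h₁, h₂, h₃, hκ, h₄, h₅, h₆⟩ := hsplit x y s t hxy hs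
      -- Tightness makes the split-off circuit critical, so it has the arcs of `c`. One of these
      -- leaves `κ`, yet the circuit avoids `κ`: this case is impossible.
      have h := hmean _ _ h₁ h₂ h₃ (by linarith [hmax _ _ h₁ h₂ h₃, hPmax _ _ h₄ h₅])
      obtain ⟨t', ht'⟩ := hc.eq_cons
      obtain ⟨z, hz⟩ : ∃ z, (κ, z) ∈ arcs c := by
        refine exists_arc_of_mem_dropLast ?_
        rw [ht'] at hcl ⊢
        cases t' with
        | nil => simp [len, arcs_singleton] at hcl
        | cons => simp
      have := (map_fst_arcs _).symm ▸ List.mem_map_of_mem (f := Prod.fst) ((h _).1 hz)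
      rw [← List.cons_append, List.dropLast_concat] at this
      rcases List.mem_cons.1 this with h' | h'
      exacts [absurd h'.symm hxκ, absurd h' hκ]
    · obtain ⟨h₁, h₂, h₃⟩ := hcons x y hx hxy
      refine hG.path_eq hc hcl hce hc.head_mem hxκ.symm (hP x).1 (hP x).2 h₁ h₂ ?_
      simp only [height] at h₃
      rw [← hρ]
      linarith
  -- A tight arc `κ → y` followed by `P y` is a critical elementary circuit, and `c` leaves `κ` only
  -- once.
  · have key : ∀ y, Tight A ρ P κ y → (κ, y) ∈ arcs c := by
      rintro y ⟨hκy, h0⟩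
      have hw := (hP y).1
      refine (hmean κ (κ :: P y) (.cons hκy hw) (by rw [hw.len_cons]; omega)
        (.cons_of_nodup hw (hP y).2) ?_ _).2 (by rw [hw.arcs_cons]; simp)
      rw [reduced, hself, height_singleton] at h0
      rw [hw.height_cons]
      linarith
    exact fun y y' h h' => arc_fst_inj hce.1 (key y h) (key y' h')

/-! ### Critical graphs with one node -/

theorem DirGraph.IsCircuit.isWalk {V : Type} {G : DirGraph V} {c : List V} (h : G.IsCircuit c) :
    ∃ i, IsWalk G.arc i i c := by
  obtain ⟨⟨hl, ha⟩, he⟩ := h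
  cases c with
  | nil => simp [len, arcs] at hl
  | cons i t => exact ⟨i, isWalk_of_arc rfl (he ▸ rfl) ha⟩

theorem IsWalk.isCircuit {V : Type} {G : DirGraph V} {c : List V} {i : V}
    (h : IsWalk G.arc i i c) (hl : 1 ≤ len c) : G.IsCircuit c := by
  have := h.isPathFromTo hl
  exact ⟨⟨hl, h.arc⟩, this.2.1.trans this.2.2.symm⟩

theorem IsWalk.exists_arc_to {V : Type} {R : V → V → Prop} {i x : V} {c : List V}
    (h : IsWalk R i i c) (hl : 1 ≤ len c) (hx : x ∈ c) : ∃ y, (y, x) ∈ arcs c := by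
  cases h with
  | single => simp [len, arcs_singleton] at hl
  | @cons _ j _ t hR h =>
    have : x ∈ t := by
      rcases List.mem_cons.1 hx with rfl | hx
      exacts [h.last_mem, hx]
    have h' : x ∈ (arcs (i :: t)).map Prod.snd := by rw [map_snd_arcs]; exact this
    simpa using h'

/-- A critical arc into `κ` must start at `κ`, so there is a critical loop, and its length `1`
forces the gcd. -/
theorem hasType_one_one {A : Mat k} {κ : Fin k} (h : (criticalGraph A).nodes = {κ}) :
    HasType A 1 1 := by
  have hmem : ∀ {i}, i ∈ (criticalGraph A).nodes ↔ i = κ := by simp [h]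
  have hsc : (criticalGraph A).StronglyConnected := by
    intro i hi j hj
    rw [hmem.1 hi, hmem.1 hj]
    exact .refl
  constructor
  · have : (criticalGraph A).components = {{κ}} := by
      ext C
      constructor
      · rintro ⟨i, hi, rfl⟩
        obtain rfl := hmem.1 hi
        ext j
        exact ⟨fun hj => hmem.1 hj.1, fun hj => by
          obtain rfl : j = i := hj
          exact ⟨hi, .refl, .refl⟩⟩
      · rintro rfl
        refine ⟨κ, hmem.2 rfl, ?_⟩
        ext j
        exact ⟨fun hj => by
          obtain rfl : j = κ := hj
          exact ⟨hmem.2 rfl, .refl, .refl⟩, fun hj => hmem.1 hj.1⟩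
    rw [this, Set.ncard_singleton]
  · rw [DirGraph.cyclicity, if_pos hsc, DirGraph.circuitGcd]
    obtain ⟨c, hc, hκ⟩ := hmem.2 rfl
    obtain ⟨i, hi⟩ := hc.1.isWalk
    obtain ⟨y, hy⟩ := hi.exists_arc_to hc.1.1.1 hκ
    have harc : (criticalGraph A).arc y κ := ⟨c, hc, hy⟩
    obtain rfl := hmem.1 ((criticalGraph A).left_mem harc)
    have hloop : IsWalk (criticalGraph A).arc y y [y, y] := .cons harc (.single y)
    have : {d : ℕ | ∀ c, (criticalGraph A).IsCircuit c → d ∣ len c} = {1} := by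
      ext d
      simp only [Set.mem_ofPred_eq, Set.mem_singleton_iff]
      refine ⟨fun h => Nat.dvd_one.1 (h _ (hloop.isCircuit le_rfl)), ?_⟩
      rintro rfl c -
      exact one_dvd _
    rw [this, csSup_singleton]

/-- A criterion for the critical graph to consist of the node `κ`. -/
theorem criticalGraph_nodes_eq {M : Mat k} (hM : HasFiniteEntries M) {κ : Fin k} {r : ℝ}
    {v : Fin k → ℝ} (hle : ∀ i j, ent M i j ≤ r + v i - v j)
    (heq : ∀ i j, ent M i j = r + v i - v j → j = κ) (hκ : r ≤ ent M κ κ) :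
    (criticalGraph M).nodes = {κ} := by
  have hfin : ∀ c : List (Fin k), ∀ a ∈ arcs c, M a.1 a.2 ≠ ⊥ := fun c a _ => hM _ _
  have hloop : IsWalk (graph M).arc κ κ [κ, κ] := .cons (hM κ κ) (.single κ)
  have hκ' : ent M κ κ = r := le_antisymm (by linarith [hle κ κ]) hκ
  have hlw : avgWeight M [κ, κ] = (r : Rmax) := by
    rw [avgWeight_eq (hfin _)]
    simp [arcSum, len, arcs_cons_cons, arcs_singleton, hκ']
  have hρ : spectralRadius M = (r : Rmax) := by
    refine le_antisymm (Finset.sup_le fun c hc => ?_) (hlw ▸ Finset.le_sup ?_)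
    · have hc := (Set.Finite.mem_toFinset _).1 hc
      obtain ⟨i, hi⟩ := hc.1.isWalk
      have := hi.arcSum_le (r := r) (u := v) (e := ent M) fun a _ => hle _ _
      rw [avgWeight_eq (hfin _)]
      refine WithBot.coe_le_coe.2 ?_
      rw [div_le_iff₀ (by exact_mod_cast hc.1.1.1)]
      linarith
    · exact (Set.Finite.mem_toFinset _).2 (hloop.mem_elemCircuits le_rfl ⟨by simp, by simp⟩)
  ext x
  constructor
  · rintro ⟨c, ⟨hc, hw⟩, hx⟩
    obtain ⟨i, hi⟩ := hc.isWalk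
    rw [hρ, avgWeight_eq (hfin _), WithBot.coe_inj] at hw
    have hl : (len c : ℝ) ≠ 0 := by
      have := hc.1.1
      positivity
    rw [div_eq_iff hl] at hw
    -- The slacks in `hle` are nonpositive and add up to zero along a critical circuit, so each of
    -- them vanishes.
    have h0 := hi.arcSum_add_coboundary (ent M) r v
    obtain ⟨y, hy⟩ := hi.exists_arc_to hc.1.1 hx
    have := eq_zero_of_arcSum_eq_zero (fun a _ => by linarith [hle a.1 a.2])
      (h0.trans (by linarith)) (y, x) hy
    exact heq y x (by linarith)
  · rintro rfl
    exact ⟨_, ⟨hloop.isCircuit le_rfl, hlw.trans hρ.symm⟩, by simp⟩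

/-! ### Walks and optimal paths -/

namespace OptimalPaths

variable {A : Mat k} {ρ : ℝ} {κ : Fin k} {c : List (Fin k)} {P : Fin k → List (Fin k)}

theorem height_path_self (h : OptimalPaths A ρ κ c P) : height A ρ (P κ) = 0 := by
  rw [h.path_self, height_singleton]

theorem arcSum_reduced {i j : Fin k} {p : List (Fin k)} (hp : IsWalk (Arc A) i j p) :
    arcSum (reduced A ρ P) p = height A ρ p + height A ρ (P j) - height A ρ (P i) :=
  hp.arcSum_add_coboundary (ent A) ρ fun i => height A ρ (P i)

theorem arcSum_circuit (h : OptimalPaths A ρ κ c P) : arcSum (reduced A ρ P) c = 0 := by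
  have hl := h.one_le_len
  have : (len c : ℝ) ≠ 0 := by positivity
  rw [arcSum_reduced h.circuit, height, h.mean, div_mul_cancel₀ _ this]
  ring

theorem arcSum_path (h : OptimalPaths A ρ κ c P) (i : Fin k) :
    arcSum (reduced A ρ P) (P i) = 0 := by
  rw [arcSum_reduced (h.isWalk i), h.height_path_self]
  ring

theorem len_path_le (h : OptimalPaths A ρ κ c P) (i : Fin k) : len (P i) ≤ k := by
  have := (h.nodup i).length_le_card
  rw [Fintype.card_fin] at this
  rw [len_eq]
  omega

theorem tight_of_arcSum_eq_zero (h : OptimalPaths A ρ κ c P) {i j : Fin k} {p : List (Fin k)}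
    (hp : IsWalk (Arc A) i j p) (h0 : arcSum (reduced A ρ P) p = 0) :
    IsWalk (Tight A ρ P) i j p :=
  hp.mono fun a ha => ⟨hp.arc a ha, eq_zero_of_arcSum_eq_zero
    (fun a ha => h.reduced_nonpos _ _ (hp.arc a ha)) h0 a ha⟩

/-- For `x ≠ κ`, the end of a tight arc from `x` is the second node of `P x`. -/
theorem tight_unique (h : OptimalPaths A ρ κ c P) (x y y' : Fin k) (hy : Tight A ρ P x y)
    (hy' : Tight A ρ P x y') : y = y' := by
  by_cases hx : x = κ
  · subst hx
    exact h.unique_of_tight _ _ hy hy'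
  · have h1 := (h.path_of_tight _ _ hy hx).symm.trans (h.path_of_tight _ _ hy' hx)
    obtain ⟨t, ht⟩ := (h.isWalk y).eq_cons
    obtain ⟨t', ht'⟩ := (h.isWalk y').eq_cons
    simp_all

/-- A walk of reduced weight zero from `i` to `κ`, as long as required. -/
theorem exists_walk_to (h : OptimalPaths A ρ κ c P) (i : Fin k) (t : ℕ) :
    ∃ r, IsWalk (Arc A) i κ r ∧ len r = len (P i) + t * len c ∧ arcSum (reduced A ρ P) r = 0 := by
  obtain ⟨q, hq, hql, hqs⟩ := h.circuit.iterate (reduced A ρ P) t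
  obtain ⟨r, hr, har⟩ := (h.isWalk i).append hq
  refine ⟨r, hr, by rw [len_of_arcs_eq har, hql], ?_⟩
  rw [arcSum_of_arcs_eq har, hqs, h.arcSum_circuit, h.arcSum_path]
  simp

/-- Long walks that avoid `κ` have a very negative reduced weight. -/
theorem exists_arcSum_le (h : OptimalPaths A ρ κ c P) :
    ∃ ε : ℝ, 0 < ε ∧ ∀ i j p, IsWalk (Arc A) i j p → κ ∉ p →
      arcSum (reduced A ρ P) p ≤ ε * (k - len p) := by
  have : Nonempty (Pos k) := ⟨(κ, κ)⟩
  -- The minimum of `g` is a positive gap `δ` below zero for the negative reduced weights; the value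
  -- `1` is a filler.
  let g : Pos k → ℝ := fun a => if reduced A ρ P a.1 a.2 < 0 then -reduced A ρ P a.1 a.2 else 1
  obtain ⟨a₀, ha₀⟩ := Finite.exists_min g
  have hδ : 0 < g a₀ := by
    simp only [g]
    split_ifs with h'
    exacts [by linarith, one_pos]
  set δ := g a₀
  have hneg : ∀ x y, reduced A ρ P x y < 0 → reduced A ρ P x y ≤ -δ := by
    intro x y hxy
    have := ha₀ (x, y)
    simp only [g, hxy, if_true] at this
    linarith
  have hk : (0 : ℝ) < k + 1 := by positivity
  refine ⟨δ / (k + 1), by positivity, fun i j p hp hκ => ?_⟩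
  set ε := δ / (k + 1) with hε
  have hεδ : δ = ε * (k + 1) := by rw [hε, div_mul_cancel₀ _ hk.ne']
  have hε0 : 0 < ε := by positivity
  -- Away from `κ`, a tight arc shortens the remaining path `P` by exactly one. Any other arc costs
  -- at least `δ = ε (k + 1)`, which pays `ε` and a lengthening by at most `k`.
  have key := hp.arcSum_le (e := reduced A ρ P) (r := -ε) (u := fun i => ε * len (P i)) ?_
  · have h1 : (len (P i) : ℝ) ≤ k := by exact_mod_cast h.len_path_le i
    have h2 : (0 : ℝ) ≤ len (P j) := by positivity
    have h3 := mul_le_mul_of_nonneg_left h1 hε0.le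
    have h4 := mul_nonneg hε0.le h2
    linarith
  · rintro ⟨x, y⟩ ha
    have hx : x ≠ κ := fun hx => hκ (hx ▸ (mem_of_mem_arcs ha).1)
    have hxy : Arc A x y := hp.arc _ ha
    rcases (h.reduced_nonpos x y hxy).lt_or_eq with hlt | h0
    · have h1 : (len (P y) : ℝ) ≤ k := by exact_mod_cast h.len_path_le y
      have h2 : (0 : ℝ) ≤ len (P x) := by positivity
      have h3 := mul_le_mul_of_nonneg_left h1 hε0.le
      have h4 := mul_nonneg hε0.le h2
      have h5 := hneg x y hlt
      rw [hεδ] at h5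
      simp only
      linarith
    · have h1 := h.path_of_tight x y ⟨hxy, h0⟩ hx
      have h2 : (len (P x) : ℝ) = len (P y) + 1 := by
        rw [h1, (h.isWalk y).len_cons]; push_cast; rfl
      simp only [h0, h2]
      linarith

/-- Walks from `κ` can be shortened without loss. -/
theorem exists_short (h : OptimalPaths A ρ κ c P) {j : Fin k} {q : List (Fin k)}
    (hq : IsWalk (Arc A) κ j q) : ∃ q', IsWalk (Arc A) κ j q' ∧ 1 ≤ len q' ∧ len q' ≤ k ∧
      arcSum (reduced A ρ P) q ≤ arcSum (reduced A ρ P) q' := by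
  cases hq with
  | single =>
    -- The walk without arcs is replaced by `c`, also of reduced weight zero, to obtain a genuine
    -- path.
    refine ⟨c, h.circuit, h.one_le_len, ?_, ?_⟩
    · have := h.elementary.1.length_le_card
      rwa [Fintype.card_fin, List.length_dropLast, ← len_eq] at this
    · rw [h.arcSum_circuit]
      simp [arcSum, arcs_singleton]
  | @cons _ x _ p hR hp =>
    obtain ⟨q, hq, hn, hle⟩ := hp.exists_nodup h.reduced_nonpos
    have := hn.length_le_card
    have hpos := List.length_pos_of_mem hq.head_mem
    rw [Fintype.card_fin] at this
    refine ⟨κ :: q, .cons hR hq, by rw [hq.len_cons]; omega, ?_, ?_⟩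
    · rw [hq.len_cons, len_eq]; omega
    · rw [hp.arcSum_cons, hq.arcSum_cons]; linarith

end OptimalPaths

/-! ### The products `A ^ m * B * A ^ n` -/

/-- The entries of `B`, normalised by the heights of the paths `P`. -/
noncomputable def relEnt (A B : Mat k) (ρ : ℝ) (P : Fin k → List (Fin k)) (a b : Fin k) : ℝ :=
  ent B a b + height A ρ (P b) - height A ρ (P a)

/-- The walk `q` from `κ` to `a`, followed by the entry `(a, b)` of `B`, is optimal, and any other
optimal one also ends at `b`. -/
structure OptimalJump (A B : Mat k) (ρ : ℝ) (κ : Fin k) (P : Fin k → List (Fin k))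
    (a b : Fin k) (q : List (Fin k)) : Prop where
  isWalk : IsWalk (Arc A) κ a q
  ne_bot : B a b ≠ ⊥
  le : ∀ a' b' q', IsWalk (Arc A) κ a' q' → B a' b' ≠ ⊥ →
    arcSum (reduced A ρ P) q' + relEnt A B ρ P a' b' ≤
      arcSum (reduced A ρ P) q + relEnt A B ρ P a b
  unique : ∀ a' b' q', IsWalk (Arc A) κ a' q' → B a' b' ≠ ⊥ →
    arcSum (reduced A ρ P) q' + relEnt A B ρ P a' b' =
      arcSum (reduced A ρ P) q + relEnt A B ρ P a b → b' = b

/-- By `exists_short`, it suffices to maximise over the finitely many walks of length between `1`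
and `k`. Shortening an optimal competitor keeps it optimal and its landing node, so `target_eq`
applies. -/
theorem OptimalPaths.exists_optimalJump {A B : Mat k} {ρ : ℝ} {κ : Fin k} {c : List (Fin k)}
    {P : Fin k → List (Fin k)} (h : OptimalPaths A ρ κ c P) (hB : B ∈ matM k)
    (hG : IsGeneric A B) : ∃ a b q, OptimalJump A B ρ κ P a b q := by
  let S : Set (Fin k × Fin k × List (Fin k)) :=
    {x | IsWalk (Arc A) κ x.1 x.2.2 ∧ (1 ≤ len x.2.2 ∧ len x.2.2 ≤ k) ∧ B x.1 x.2.1 ≠ ⊥}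
  have hS : S.Finite := by
    refine (Set.finite_univ.prod (Set.finite_univ.prod
      (List.finite_length_le (Fin k) (k + 1)))).subset fun x hx => ?_
    have := hx.2.1.2
    rw [len_eq] at this
    simp only [Set.mem_prod, Set.mem_univ, Set.mem_ofPred_eq, true_and]
    omega
  let f : Fin k × Fin k × List (Fin k) → ℝ := fun x =>
    arcSum (reduced A ρ P) x.2.2 + relEnt A B ρ P x.1 x.2.1
  obtain ⟨d, hd⟩ := hB κ
  obtain ⟨q₀, hq₀, h₀, h₀', -⟩ := h.exists_short (.single κ)
  obtain ⟨⟨a, b, q⟩, hx, hmax⟩ := hS.exists_maximalFor f S ⟨(κ, d, q₀), hq₀, ⟨h₀, h₀'⟩, hd⟩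
  have hmax' : ∀ a' b' q', IsWalk (Arc A) κ a' q' → 1 ≤ len q' → len q' ≤ k → B a' b' ≠ ⊥ →
      arcSum (reduced A ρ P) q' + relEnt A B ρ P a' b' ≤
        arcSum (reduced A ρ P) q + relEnt A B ρ P a b := by
    intro a' b' q' h₁ h₂ h₃ h₄
    by_contra! hlt
    exact absurd (hmax (j := (a', b', q')) ⟨h₁, ⟨h₂, h₃⟩, h₄⟩ hlt.le) (not_le.2 hlt)
  refine ⟨a, b, q, hx.1, hx.2.2, ?_, ?_⟩
  · intro a' b' q' hq' hb'
    obtain ⟨q'', h₁, h₂, h₃, h₄⟩ := h.exists_short hq'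
    linarith [hmax' a' b' q'' h₁ h₂ h₃ hb']
  · intro a' b' q' hq' hb' heq
    obtain ⟨q'', h₁, h₂, h₃, h₄⟩ := h.exists_short hq'
    have h₅ := hmax' a' b' q'' h₁ h₂ h₃ hb'
    refine hG.target_eq h.circuit h.one_le_len h.elementary h.isWalk h.nodup h.path_self h₁ h₂ h₃
      hx.1 hx.2.1.1 hx.2.1.2 hb' hx.2.2 ?_
    have h₆ : arcSum (reduced A ρ P) q'' + relEnt A B ρ P a' b' =
        arcSum (reduced A ρ P) q + relEnt A B ρ P a b := le_antisymm h₅ (by linarith)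
    rw [OptimalPaths.arcSum_reduced h₁, OptimalPaths.arcSum_reduced hx.1] at h₆
    simp only [relEnt] at h₆
    rw [← h.mean]
    simp only [height] at h₆ ⊢
    linarith

theorem hasFiniteEntries_mul_mul {A B : Mat k} (hA : A ∈ matM k) (hB : B ∈ matM k) (m : ℕ) {n : ℕ}
    (hn : HasFiniteEntries (pow A n)) : HasFiniteEntries (mul (mul (pow A m) B) (pow A n)) := by
  intro i j
  obtain ⟨a, ha⟩ := exists_pow_ne_bot hA m i
  obtain ⟨b, hb⟩ := hB a
  exact mul_ne_bot (mul_ne_bot ha hb) (hn b j)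

/-- The entries of `A ^ m * B * A ^ n` bound the weights of the walks with a jump. -/
theorem le_ent_mul_mul {A B : Mat k} {m n : ℕ}
    (hM : HasFiniteEntries (mul (mul (pow A m) B) (pow A n))) {i j a b : Fin k}
    {p q : List (Fin k)} (hp : IsWalk (Arc A) i a p) (hm : len p = m) (hab : B a b ≠ ⊥)
    (hq : IsWalk (Arc A) b j q) (hn : len q = n) :
    arcSum (ent A) p + ent B a b + arcSum (ent A) q ≤
      ent (mul (mul (pow A m) B) (pow A n)) i j := by
  rw [← WithBot.coe_le_coe, coe_ent (hM i j), WithBot.coe_add, WithBot.coe_add, coe_ent hab]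
  exact (add_le_add ((add_le_add (hp.le_pow hm) le_rfl).trans (add_le_mul _ _ _ _ _))
    (hq.le_pow hn)).trans (add_le_mul _ _ _ _ _)

/-- The entries of `A ^ m * B * A ^ n` are weights of walks with a jump. -/
theorem exists_ent_mul_mul_eq {A B : Mat k} {m n : ℕ}
    (hM : HasFiniteEntries (mul (mul (pow A m) B) (pow A n))) (i j : Fin k) :
    ∃ a b p q, IsWalk (Arc A) i a p ∧ len p = m ∧ B a b ≠ ⊥ ∧ IsWalk (Arc A) b j q ∧ len q = n ∧
      ent (mul (mul (pow A m) B) (pow A n)) i j =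
        arcSum (ent A) p + ent B a b + arcSum (ent A) q := by
  have hij := hM i j
  have hco := coe_ent hij
  obtain ⟨b, hb⟩ := exists_mul_eq (mul (pow A m) B) (pow A n) i j
  obtain ⟨a, ha⟩ := exists_mul_eq (pow A m) B i b
  rw [hb, ha] at hij hco
  simp only [ne_eq, WithBot.add_eq_bot, not_or] at hij
  obtain ⟨p, hp, hpm, hpw⟩ := exists_isWalk_of_pow hij.1.1
  obtain ⟨q, hq, hqn, hqw⟩ := exists_isWalk_of_pow hij.2
  refine ⟨a, b, p, q, hp, hpm, hij.1.2, hq, hqn, ?_⟩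
  rw [hpw, hqw, ← coe_ent hij.1.2] at hco
  exact_mod_cast hco

theorem exists_nodes_eq_singleton (hk : 0 < k) {A B : Mat k} (hA : A ∈ matP k) (hB : B ∈ matM k)
    (hG : IsGeneric A B) : ∃ m n, HasFiniteEntries (mul (mul (pow A m) B) (pow A n)) ∧
      ∃ κ, (criticalGraph (mul (mul (pow A m) B) (pow A n))).nodes = {κ} := by
  obtain ⟨ρ, κ, c, P, h⟩ := exists_optimalPaths hk hA hG
  obtain ⟨a, b, q, hJ⟩ := h.exists_optimalJump hB hG
  obtain ⟨ε, hε, hesc⟩ := h.exists_arcSum_le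
  obtain ⟨N, hN⟩ := exists_forall_hasFiniteEntries hA
  set e := reduced A ρ P with he
  set μ := arcSum e q + relEnt A B ρ P a b with hμ
  have : Nonempty (Pos k) := ⟨(κ, κ)⟩
  obtain ⟨x₀, hx₀⟩ := Finite.exists_max fun x : Pos k => relEnt A B ρ P x.1 x.2
  set C := relEnt A B ρ P x₀.1 x₀.2
  -- So many laps of `c` that a first walk avoiding `κ` stays below `μ` even with the best entry `C`
  -- of `B`.
  obtain ⟨t, ht⟩ := exists_nat_gt (k + (C - μ) / ε)
  set m := t * len c + len q with hm
  -- The length of a tight walk from `b` to `κ`; the `N` laps ensure that `A^n` has only finite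
  -- entries.
  set n := len (P b) + N * len c with hn
  have hcl := h.one_le_len
  have hm' : ε * (k - m) + C < μ := by
    have h1 : (t : ℝ) ≤ m := by
      exact_mod_cast (Nat.le_mul_of_pos_right t hcl).trans (Nat.le_add_right _ _)
    have h2 : (C - μ) / ε < m - k := by linarith
    rw [div_lt_iff₀ hε] at h2
    linarith
  have hM : HasFiniteEntries (mul (mul (pow A m) B) (pow A n)) :=
    hasFiniteEntries_mul_mul hA.1 hB m
      (hN n ((Nat.le_mul_of_pos_right N hcl).trans (Nat.le_add_left _ _)))
  obtain ⟨r, hr, hrl, hrs⟩ := h.exists_walk_to b N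
  have hval : ∀ {i j a b : Fin k} {p q : List (Fin k)}, IsWalk (Arc A) i a p → len p = m →
      IsWalk (Arc A) b j q → len q = n →
      arcSum (ent A) p + ent B a b + arcSum (ent A) q =
        (arcSum e p + relEnt A B ρ P a b + arcSum e q) + ρ * (m + n) + height A ρ (P i) -
          height A ρ (P j) := by
    intro i j a b p q hp hpm hq hqn
    rw [he, OptimalPaths.arcSum_reduced hp, OptimalPaths.arcSum_reduced hq, relEnt, height.eq_def A ρ p,
      height.eq_def A ρ q, hpm, hqn]
    ring
  have hbound : ∀ {i j a' b' : Fin k} {p q' : List (Fin k)}, IsWalk (Arc A) i a' p → len p = m →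
      B a' b' ≠ ⊥ → IsWalk (Arc A) b' j q' → len q' = n →
      arcSum e p + relEnt A B ρ P a' b' + arcSum e q' ≤ μ ∧
        (arcSum e p + relEnt A B ρ P a' b' + arcSum e q' = μ → j = κ) := by
    intro i j a' b' p q' hp hpm hb' hq' hqn
    have hq0 := hq'.arcSum_nonpos h.reduced_nonpos
    by_cases hκ : κ ∈ p
    -- The part after a visit to `κ`, together with the jump, gains at most `μ`; the rest is
    -- nonpositive. Equality forces the landing node `b` and a tight last walk, which must then be
    -- `r`.
    · obtain ⟨s, s', rfl⟩ := List.append_of_mem hκ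
      have hs0 := hp.left.arcSum_nonpos h.reduced_nonpos
      have hle := hJ.le a' b' _ hp.right hb'
      rw [arcSum_append_cons]
      refine ⟨by linarith, fun heq => ?_⟩
      obtain rfl := hJ.unique a' b' _ hp.right hb' (by linarith)
      exact ((h.tight_of_arcSum_eq_zero hq' (by linarith)).eq_of_unique h.tight_unique
        (h.tight_of_arcSum_eq_zero hr hrs) (hqn.trans hrl.symm)).1
    · have h1 := hesc _ _ p hp hκ
      have h2 := hx₀ (a', b')
      rw [hpm] at h1
      simp only at h2
      exact ⟨by linarith, fun heq => by linarith⟩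
  refine ⟨m, n, hM, κ, criticalGraph_nodes_eq hM (r := μ + ρ * (m + n))
    (v := fun i => height A ρ (P i)) ?_ ?_ ?_⟩
  · intro i j
    obtain ⟨a', b', p, q', hp, hpm, hb', hq', hqn, heq⟩ := exists_ent_mul_mul_eq hM i j
    rw [heq, hval hp hpm hq' hqn]
    linarith [(hbound hp hpm hb' hq' hqn).1]
  · intro i j hij
    obtain ⟨a', b', p, q', hp, hpm, hb', hq', hqn, heq⟩ := exists_ent_mul_mul_eq hM i j
    rw [heq, hval hp hpm hq' hqn] at hij
    exact (hbound hp hpm hb' hq' hqn).2 (by linarith)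
  -- The bound is attained at `(κ, κ)` by `t` laps of `c`, then the optimal jump, then `r`.
  · obtain ⟨s, hs, hsl, hss⟩ := h.circuit.iterate e t
    obtain ⟨p, hp, hap⟩ := hs.append hJ.isWalk
    have hpm : len p = m := by rw [len_of_arcs_eq hap, hsl]
    have hle := le_ent_mul_mul hM hp hpm hJ.ne_bot hr hrl
    rw [hval hp hpm hr hrl, arcSum_of_arcs_eq hap, hss, h.arcSum_circuit, hrs] at hle
    linarith

/-! ### Finiteness and non-triviality of the family of linear forms -/

theorem IsElementary.length_le {p : List (Fin k)} (h : IsElementary p) : p.length ≤ k + 1 := by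
  have := h.1.length_le_card
  rw [List.length_dropLast, Fintype.card_fin] at this
  omega

theorem formsE1_finite (k : ℕ) : (formsE1 k).Finite := by
  refine (((elemCircuits_finite k).prod (elemCircuits_finite k)).image
    fun x => avgForm x.1 - avgForm x.2).subset ?_
  rintro α ⟨c, hc, d, hd, -, rfl⟩
  exact ⟨(c, d), ⟨hc, hd⟩, rfl⟩

theorem formsE2_finite (k : ℕ) : (formsE2 k).Finite := by
  have hL := List.finite_length_le (Fin k) (k + 1)
  refine ((hL.prod (hL.prod hL)).image fun x => weightForm x.1 - (len x.1 : ℝ) • avgForm x.2.2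
    - weightForm x.2.1 + (len x.2.1 : ℝ) • avgForm x.2.2).subset ?_
  rintro α ⟨i, κ, p, q, c, -, hp, hq, -, hc, -, rfl⟩
  exact ⟨(p, q, c), ⟨hp.2.length_le, hq.2.length_le, hc.2.length_le⟩, rfl⟩

theorem formsE3_finite (k : ℕ) : (formsE3 k).Finite := by
  -- A form depends on `p` only through five of its values, hence on four nodes and seven lists.
  -- Since `|p κ| ≤ k`, the lists `q₁` and `q₂` have at most `k * k + 1` nodes.
  have hL := List.finite_length_le (Fin k) ((k + 1) * (k + 1))
  refine ((Set.finite_univ (α := Fin 4 → Fin k)).prod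
    (Set.Finite.pi (ι := Fin 7) fun _ => hL)).image (fun x => Sum.elim
      (weightForm (x.2 0) - weightForm (x.2 1) + weightForm (x.2 2)
        - weightForm (x.2 3) + weightForm (x.2 4) - weightForm (x.2 5)
        - ((len (x.2 0) : ℝ) - len (x.2 1) + len (x.2 2) - len (x.2 3) + len (x.2 4)
          - len (x.2 5)) • avgForm (x.2 6))
      (Pi.single (x.1 0, x.1 1) 1 - Pi.single (x.1 2, x.1 3) 1)) |>.subset ?_
  rintro α ⟨i₁, i₂, j₁, j₂, m₁, m₂, κ, p, q₁, q₂, -, hp, -, hq₁, -, hq₂, rfl⟩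
  have hlen : ∀ i ∈ ({i₁, i₂, m₁, m₂, κ} : Set (Fin k)), (p i).length ≤ (k + 1) * (k + 1) :=
    fun i hi => (hp i hi).2.length_le.trans (Nat.le_mul_of_pos_right _ k.succ_pos)
  have hκ : len (p κ) ≤ k := by
    have := (hp κ (by simp)).2.length_le
    rw [len_eq]
    omega
  have hq : ∀ q : List (Fin k), len q ≤ len (p κ) * k → q.length ≤ (k + 1) * (k + 1) := by
    intro q h
    have h2 := h.trans (Nat.mul_le_mul_right k hκ)
    rw [len_eq] at h2
    nlinarith [Nat.sub_le_iff_le_add.1 h2]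
  refine ⟨(![j₁, m₁, j₂, m₂], ![q₁, p i₁, p m₁, q₂, p i₂, p m₂, p κ]), ⟨Set.mem_univ _, ?_⟩, rfl⟩
  intro l _
  fin_cases l
  exacts [hq _ hq₁, hlen _ (by simp), hlen _ (by simp), hq _ hq₂, hlen _ (by simp),
    hlen _ (by simp), hlen _ (by simp)]

theorem genericForms_finite (k : ℕ) : (genericForms k).Finite := by
  refine ((((formsE1_finite k).union (formsE2_finite k)).image
    fun β => (Sum.elim β 0 : Pos k ⊕ Pos k → ℝ)).union (formsE3_finite k)).subset ?_
  rintro α (⟨β, hβ, rfl⟩ | h)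
  exacts [.inl ⟨β, hβ, rfl⟩, .inr h]

/-- An arc that lies on only one of the circuits has a nonzero coefficient. -/
theorem formsE1_ne_zero {α : Pos k → ℝ} (h : α ∈ formsE1 k) : α ≠ 0 := by
  rintro rfl
  obtain ⟨c, hc, d, hd, hne, h0⟩ := h
  refine hne (Finset.ext fun a => ?_)
  have ha : avgForm c a = avgForm d a := (sub_eq_zero.1 (congrFun h0 a).symm)
  rw [List.mem_toFinset, List.mem_toFinset]
  constructor
  · intro h
    by_contra h'
    exact (avgForm_pos h).ne' (ha.trans (avgForm_eq_zero h'))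
  · intro h
    by_contra h'
    exact (avgForm_pos h).ne' (ha.symm.trans (avgForm_eq_zero h'))

theorem IsElemPath.isWalk {i j : Fin k} {p : List (Fin k)} (h : IsElemPath i j p) :
    IsWalk (fun _ _ => True) i j p :=
  isWalk_of_arc h.1.2.1 h.1.2.2 fun _ _ => trivial

/-- An elementary path that is not closed has no arc out of its last node. -/
theorem IsElemPath.not_mem_arcs {i κ x : Fin k} {p : List (Fin k)} (h : IsElemPath i κ p)
    (hi : κ ≠ i) : (κ, x) ∉ arcs p := by
  intro hx
  have hd : κ ∈ p.dropLast := by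
    rw [← map_fst_arcs]
    exact List.mem_map_of_mem (f := Prod.fst) hx
  have hn := h.2.2
  have hw := h.isWalk
  cases hw with
  | single => exact hi rfl
  | cons _ hw =>
    obtain ⟨s, rfl⟩ := hw.eq_append
    rw [← List.cons_append, List.dropLast_concat, List.mem_cons] at hd
    rw [List.tail_cons, List.nodup_append] at hn
    exact hn.2.2 κ (hd.resolve_left hi) κ (by simp) rfl

/-- Neither path has an arc out of `κ`, but `c` has one. If its coefficient vanishes, the paths have
equal lengths and the terms in `c` cancel. Every arc of `q` is then an arc of `p`, which leaves each
node at most once, so the paths coincide. -/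
theorem formsE2_ne_zero {α : Pos k → ℝ} (h : α ∈ formsE2 k) : α ≠ 0 := by
  rintro rfl
  obtain ⟨i, κ, p, q, c, hi, hp, hq, hne, hc, hκ, h0⟩ := h
  obtain ⟨z, hz⟩ : ∃ z, (κ, z) ∈ arcs c := by
    obtain ⟨j, hj⟩ := hc.1.isWalk
    have hl := hc.1.1.1
    refine exists_arc_of_mem_dropLast ?_
    cases hj with
    | single => simp [len, arcs_singleton] at hl
    | cons _ hw =>
      obtain ⟨s, rfl⟩ := hw.eq_append
      rw [← List.cons_append, List.dropLast_concat]
      simp only [List.mem_cons, List.mem_append, List.not_mem_nil, or_false] at hκ ⊢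
      tauto
  have hlen : len p = len q := by
    have h1 := congrFun h0 (κ, z)
    simp only [Pi.zero_apply, Pi.add_apply, Pi.sub_apply, Pi.smul_apply, smul_eq_mul,
      weightForm_eq_zero (hp.not_mem_arcs hi), weightForm_eq_zero (hq.not_mem_arcs hi)] at h1
    have h2 : ((len q : ℝ) - len p) * avgForm c (κ, z) = 0 := by linarith
    have h3 := (mul_eq_zero.1 h2).resolve_right (avgForm_pos hz).ne'
    exact_mod_cast (sub_eq_zero.1 h3).symm
  have harc : ∀ a ∈ arcs q, a ∈ arcs p := by
    intro a ha
    by_contra hap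
    have h1 := congrFun h0 a
    simp only [Pi.zero_apply, Pi.add_apply, Pi.sub_apply, Pi.smul_apply, smul_eq_mul,
      weightForm_eq_zero hap, hlen] at h1
    linarith [weightForm_pos ha]
  have hunique : ∀ x y y', (x, y) ∈ arcs p → (x, y') ∈ arcs p → y = y' :=
    fun x y y' hy hy' => arc_fst_inj hp.2.1 hy hy'
  have hpp : IsWalk (fun x y => (x, y) ∈ arcs p) i κ p := hp.isWalk.mono fun a ha => ha
  exact hne (hpp.eq_of_unique hunique (hq.isWalk.mono fun a ha => harc a ha) hlen).2

/-- Since `m₁ ≠ m₂`, the coefficient of the entry `(j₁, m₁)` of `B` is `1`. -/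
theorem formsE3_ne_zero {α : Pos k ⊕ Pos k → ℝ} (h : α ∈ formsE3 k) : α ≠ 0 := by
  rintro rfl
  obtain ⟨i₁, i₂, j₁, j₂, m₁, m₂, κ, p, q₁, q₂, hne, -, -, -, -, -, h0⟩ := h
  have h1 := congrFun h0 (.inr (j₁, m₁))
  simp [hne] at h1

theorem genericForms_ne_zero {α : Pos k ⊕ Pos k → ℝ} (h : α ∈ genericForms k) : α ≠ 0 := by
  rcases h with ⟨β, hβ, rfl⟩ | h
  · intro h0
    have hβ0 : β = 0 := funext fun a => congrFun h0 (.inl a)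
    exact hβ.elim (fun h => formsE1_ne_zero h hβ0) fun h => formsE2_ne_zero h hβ0
  · exact formsE3_ne_zero h

end MaxPlus

theorem lemma3 (k : ℕ) (hk : 0 < k) :
    (MaxPlus.genericForms k).Finite ∧
    (∀ α ∈ MaxPlus.genericForms k, α ≠ 0) ∧
    ∀ A ∈ MaxPlus.matP k, ∀ B ∈ MaxPlus.matM k,
      (A, B) ∉ ⋃ α ∈ MaxPlus.genericForms k, MaxPlus.hyperplane α →
      ∃ m n : ℕ,
        MaxPlus.HasFiniteEntries
          (MaxPlus.mul (MaxPlus.mul (MaxPlus.pow A m) B) (MaxPlus.pow A n)) ∧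
        (∃ l : Fin k,
          (MaxPlus.criticalGraph
            (MaxPlus.mul (MaxPlus.mul (MaxPlus.pow A m) B) (MaxPlus.pow A n))).nodes = {l}) ∧
        MaxPlus.HasType
          (MaxPlus.mul (MaxPlus.mul (MaxPlus.pow A m) B) (MaxPlus.pow A n)) 1 1 := by
  refine ⟨MaxPlus.genericForms_finite k, fun α => MaxPlus.genericForms_ne_zero,
    fun A hA B hB hAB => ?_⟩
  have hG : MaxPlus.IsGeneric A B := fun α hα h0 =>
    hAB (Set.mem_biUnion hα ⟨hA, hB, h0⟩)
  obtain ⟨m, n, hM, l, hl⟩ := MaxPlus.exists_nodes_eq_singleton hk hA hB hG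
  exact ⟨m, n, hM, ⟨l, hl⟩, MaxPlus.hasType_one_one hl⟩
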